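/- Write every ordinal $\alpha<\varepsilon_0$ in the form $\alpha=\omega^{\alpha_0}+\dots+\omega^{\alpha_n}$ with $\alpha>\alpha_0\ge\dots\ge\alpha_n$ (the empty sum is $0$). For $x\in\mathbb N$ define the fundamental sequence by $0[x]=0$, $(\alpha+1)[x]=\alpha$, and, for $\alpha$ a limit, \[ \alpha[x]=\omega^{\alpha_0}+\dots+\omega^{\alpha_{n-1}}+\omega^{\beta}\cdot x \ \text{ if } \alpha_n=\beta+1,\qquad \alpha[x]=\omega^{\alpha_0}+\dots+\omega^{\alpha_{n-1}}+\omega^{\alpha_n[x]} \ \text{ if } \alpha_n \text{ is a limit.} \] A finite set $X=\{x_0<\dots<x_{k-1}\}\subseteq\mathbb N$ is called $\alpha$-large if $\alpha[x_0][x_1]\cdots[x_{k-1}]=0$. Let $\omega_0(\alpha)=\alpha$ and $\omega_{d+1}(\alpha)=\omega^{\omega_d(\alpha)}$. For a colouring $C\colon[X]^{m}\to\{0,\dots,c-1\}$ of the $m$-element subsets of $X$, a set $H\subseteq X$ is homogeneous if $C$ is constant on $[H]^{m}$. Let $d,c\in\mathbb N$ and let $X\subseteq\mathbb N$ be a finite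 set all of whose elements are $\ge 3$. 1. If $X$ is $\omega_d(\omega^{c+4}+d)$-large, then every colouring $C\colon[X]^{d+2}\to\{0,\dots,c-1\}$ has a nonempty homogeneous set $H\subseteq X$ with $|H|>\min H$. 2. (Ketonen--Solovay) If $X$ is $\omega_{d+1}(c+5)$-large, then every colouring $C\colon[X]^{d+2}\to\{0,\dots,c-1\}$ has a nonempty homogeneous set $H\subseteq X$ with $|H|>\min H$. -/

import Mathlib

namespace KetonenSolovay

/-! Ordinals below `ε₀` are represented by Mathlib's `NONote`, the Cantor normal forms
`ω ^ e₁ * n₁ + ... + ω ^ eₖ * nₖ` with `e₁ > ... > eₖ` hereditarily in normal form and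
positive integers `nᵢ`. -/

/-- `ω ^ e * k + r`, where `k` is a natural number. -/
def lead (e : ONote) : ℕ → ONote → ONote
  | 0, r => r
  | k + 1, r => ONote.oadd e k.succPNat r

/-- `some b` if the ordinal is a successor `b + 1`, and `none` if it is zero or a limit. -/
def predOpt : ONote → Option ONote
  | ONote.zero => none
  | ONote.oadd e n a =>
      if e = 0 then some (ONote.ofNat n.natPred) else (predOpt a).map (ONote.oadd e n)

/-- The fundamental sequence `α[x]` on notations: only the last summand `ω ^ e` of `α` changes.
It becomes `0` if `e = 0`, `ω ^ b * x` if `e = b + 1`, and `ω ^ (e[x])` if `e` is a limit. -/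
def fundNote : ONote → ℕ → ONote
  | ONote.zero, _ => 0
  | ONote.oadd e n a, x =>
      if a = 0 then
        lead e n.natPred
          (if e = 0 then 0 else
            match predOpt e with
            | some b => lead b x 0
            | none => ONote.oadd (fundNote e x) 1 0)
      else ONote.oadd e n (fundNote a x)

theorem lead_nf {e r : ONote} (he : e.NF) (hr : r.NF) (h : r.repr < Ordinal.omega0 ^ e.repr)
    (k : ℕ) : (lead e k r).NF := by
  cases k with
  | zero => exact hr
  | succ k => exact ONote.NF.oadd he _ (ONote.NF.below_of_lt' h hr)

theorem repr_lead (e r : ONote) (k : ℕ) :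
    (lead e k r).repr = Ordinal.omega0 ^ e.repr * k + r.repr := by
  cases k with
  | zero => simp [lead]
  | succ k => simp [lead, ONote.repr]

theorem predOpt_spec {o b : ONote} (ho : o.NF) (h : predOpt o = some b) :
    b.NF ∧ o.repr = b.repr + 1 := by
  induction o generalizing b with
  | zero => simp [predOpt] at h
  | oadd e n a _ iha =>
    rw [predOpt] at h
    split_ifs at h with he
    · have ha := ho.zero_of_zero he
      obtain rfl := Option.some.inj h
      refine ⟨inferInstance, ?_⟩
      subst he ha
      have hn : (n : ℕ) = n.natPred + 1 := (PNat.natPred_add_one n).symm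
      simp only [ONote.repr, ONote.repr_ofNat, Ordinal.opow_zero, one_mul, add_zero]
      exact_mod_cast hn
    · obtain ⟨c, hc, rfl⟩ := Option.map_eq_some_iff.1 h
      obtain ⟨hcn, hcr⟩ := iha ho.snd hc
      refine ⟨ONote.NF.oadd ho.fst _ (ONote.NF.below_of_lt' ?_ hcn), ?_⟩
      · refine lt_of_le_of_lt ?_ ho.snd'.repr_lt
        rw [hcr]
        exact (Order.lt_succ c.repr).le
      · simp [ONote.repr, hcr, add_assoc]

theorem fundNote_spec {o : ONote} (ho : o.NF) (x : ℕ) :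
    (fundNote o x).NF ∧ (o ≠ 0 → (fundNote o x).repr < o.repr) := by
  induction o with
  | zero => exact ⟨ONote.NF.zero, fun h => absurd rfl h⟩
  | oadd e n a ihe iha =>
    have hpos : ∀ b : Ordinal.{0}, 0 < Ordinal.omega0 ^ b :=
      fun b => Ordinal.opow_pos b Ordinal.omega0_pos
    rw [fundNote]
    split_ifs with ha he
    · subst he
      refine ⟨lead_nf ONote.NF.zero ONote.NF.zero (by simp) _, fun _ => ?_⟩
      rw [repr_lead, ha]
      simp only [ONote.repr, add_zero, Ordinal.opow_zero, one_mul]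
      rw [← PNat.natPred_add_one n]
      exact_mod_cast Nat.lt_succ_self _
    · have key : ∀ r : ONote, r.NF → r.repr < Ordinal.omega0 ^ e.repr →
          (lead e n.natPred r).NF ∧
            (ONote.oadd e n a ≠ 0 → (lead e n.natPred r).repr < (ONote.oadd e n a).repr) := by
        intro r hr h
        refine ⟨lead_nf ho.fst hr h _, fun _ => ?_⟩
        rw [repr_lead, ha]
        simp only [ONote.repr, add_zero]
        rw [← PNat.natPred_add_one n, Nat.cast_add, Nat.cast_one, mul_add, mul_one]
        exact (add_lt_add_iff_left _).2 h
      split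
      · next b hb =>
        obtain ⟨hbn, hbr⟩ := predOpt_spec ho.fst hb
        refine key _ (lead_nf hbn ONote.NF.zero (by simpa using hpos _) _) ?_
        rw [repr_lead, hbr, ← Order.succ_eq_add_one, Ordinal.opow_succ]
        simpa using (mul_lt_mul_iff_right₀ (hpos b.repr)).2 (Ordinal.natCast_lt_omega0 x)
      · obtain ⟨h1, h2⟩ := ihe ho.fst
        refine key _ (ONote.NF.oadd_zero _ _) ?_
        simpa [ONote.repr] using
          (Ordinal.opow_lt_opow_iff_right Ordinal.one_lt_omega0).2 (h2 he)
    · obtain ⟨h1, h2⟩ := iha ho.snd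
      refine ⟨ONote.NF.oadd ho.fst _
        (ONote.NF.below_of_lt' ((h2 ha).trans ho.snd'.repr_lt) h1), fun _ => ?_⟩
      exact (add_lt_add_iff_left _).2 (h2 ha)

/-- The fundamental sequence `α[x]` for `α < ε₀`. -/
def fund (α : NONote) (x : ℕ) : NONote :=
  ⟨fundNote α.1 x, (fundNote_spec α.2 x).1⟩

/-- A finite set `X = {x₀ < ... < xₖ}` is `α`-large if `α[x₀]...[xₖ] = 0`. -/
def IsLarge (α : NONote) (X : Finset ℕ) : Prop :=
  (X.sort (· ≤ ·)).foldl fund α = 0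

/-- `ω ^ α`. -/
def omegaPow (α : NONote) : NONote :=
  NONote.oadd α 1 0 ONote.NFBelow.zero

/-- `ω_d(α)`: `ω_0(α) = α` and `ω_{d+1}(α) = ω ^ (ω_d(α))`. -/
def omegaTower : ℕ → NONote → NONote
  | 0, α => α
  | d + 1, α => omegaPow (omegaTower d α)

/-- Colourings of the `n`-element subsets of `X` with the colours `0, ..., c - 1`. -/
abbrev Colouring (X : Finset ℕ) (n c : ℕ) : Type :=
  {s : Finset ℕ // s ⊆ X ∧ s.card = n} → Fin c

/-- `C` is constant on the `n`-element subsets of `H`. -/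
def Homogeneous {X : Finset ℕ} {n c : ℕ} (C : Colouring X n c) (H : Finset ℕ) : Prop :=
  ∀ s t, s.1 ⊆ H → t.1 ⊆ H → C s = C t

/-- Every colouring of the `n`-element subsets of `X` with `c` colours has a homogeneous set
`H ⊆ X` of size `> min H`. -/
def HasLargeHomogeneous (X : Finset ℕ) (n c : ℕ) : Prop :=
  ∀ C : Colouring X n c, ∃ H ⊆ X, Homogeneous C H ∧ ∃ hH : H.Nonempty, H.min' hH < H.card

end KetonenSolovay

namespace KetonenSolovay

open Ordinal Finset

/-! Both statements follow from one: it suffices that `α` lies between `tower d (ω ^ (c + 4))` and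
`tower (d + 1) ω`. Suppose a colouring of `(d + 2)`-tuples of `X` has no large homogeneous set.
Insert the elements of `X` in increasing order into its Erdős–Rado tree. Each open position (slot)
is a branch together with the colouring that a later element would induce on it. An arriving element
fills one slot and replaces it by finitely many child slots.

Slots receive ordinal values exceeding the natural sum of their children's values (`IsRanking`), so
the total strictly decreases with each element. For colourings of singletons, the exponent counts
unused colours and the coefficient measures the room left in used classes (`isRanking_base`). One
dimension higher, a branch gets `ω` to the value of its own tree plus 3 (`IsRanking.lift`); each
dimension adds one exponential to the ordinal while the coefficient bounds stay the same.

On the other side, `α[x]` is at least every `δ < α` whose coefficients are hereditarily below `x`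
(`le_fundNote`). The tree values have coefficients of triple exponential size, too large for a
direct comparison. A reserve `ω ^ 3` pays for waiting until time `grow 3 x`, which exceeds them; as
all exponents are at least 3, every drop of the tree value restores the reserve (`descent_pos`).
Hence the descent from `α` along `X` never reaches 0, contradicting largeness. -/

/-! ### Formal natural sums and their ordinal values -/

/-- Formal natural sums `∑ ω ^ e * f e`, compared by their largest differing exponent. -/
abbrev Form : Type 1 := Colex (Ordinal.{0} →₀ ℕ)

/-- The multiplicity of `ω ^ e` in a formal sum. -/
def Form.coef (f : Form) (e : Ordinal.{0}) : ℕ := (ofColex f) e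

/-- The formal sum `ω ^ e * n`. -/
noncomputable def mono (e : Ordinal.{0}) (n : ℕ) : Form := toColex (Finsupp.single e n)

/-- The coefficients of a formal sum as ordinals. -/
noncomputable def Form.ordCoef (f : Form) : Ordinal.{0} →₀ Ordinal.{0} :=
  (ofColex f).mapRange Nat.cast Nat.cast_zero

/-- The ordinal denoted by a formal sum. -/
noncomputable def Form.val (f : Form) : Ordinal.{0} := CNF.eval ω f.ordCoef

@[simp] theorem ordCoef_apply (f : Form) (e : Ordinal) : f.ordCoef e = (f.coef e : Ordinal) := rfl

theorem ordCoef_lt (f : Form) (e : Ordinal) : f.ordCoef e < ω := by simp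

@[simp] theorem coef_zero (e : Ordinal) : (0 : Form).coef e = 0 := rfl

@[simp] theorem coef_add (f g : Form) (e : Ordinal) : (f + g).coef e = f.coef e + g.coef e := rfl

@[simp] theorem coef_mono_same (e : Ordinal) (n : ℕ) : (mono e n).coef e = n :=
  Finsupp.single_eq_same

theorem coef_mono_of_ne {e e' : Ordinal} (h : e' ≠ e) (n : ℕ) : (mono e n).coef e' = 0 :=
  Finsupp.single_eq_of_ne h

theorem coef_mono (e e' : Ordinal) (n : ℕ) :
    (mono e n).coef e' = if e' = e then n else 0 := by
  split_ifs with h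
  · rw [h, coef_mono_same]
  · exact coef_mono_of_ne h n

theorem Form.lt_iff {f g : Form} :
    f < g ↔ ∃ i, (∀ j, i < j → f.coef j = g.coef j) ∧ f.coef i < g.coef i :=
  Finsupp.Colex.lt_iff

theorem Form.ext {f g : Form} (h : ∀ e, f.coef e = g.coef e) : f = g :=
  ofColex.injective (Finsupp.ext h)

theorem ordCoef_add (f g : Form) : (f + g).ordCoef = f.ordCoef + g.ordCoef := by
  ext e; simp

@[simp] theorem val_zero : (0 : Form).val = 0 := by
  have : (0 : Form).ordCoef = 0 := by ext e; simp
  rw [Form.val, this, CNF.eval_zero_right]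

@[simp] theorem val_mono (e : Ordinal) (n : ℕ) : (mono e n).val = ω ^ e * n := by
  have : (mono e n).ordCoef = Finsupp.single e (n : Ordinal) := by
    ext e'
    rw [ordCoef_apply, coef_mono, Finsupp.single_apply]
    simp only [eq_comm]
    split_ifs <;> simp
  rw [Form.val, this, CNF.eval_single]

theorem val_add {f g : Form} (h : ∀ e e', f.coef e ≠ 0 → g.coef e' ≠ 0 → e' ≤ e) :
    (f + g).val = f.val + g.val := by
  rw [Form.val, ordCoef_add, CNF.eval_add]
  · rfl
  · intro e he e' he'
    rw [Finsupp.mem_support_iff, ordCoef_apply, Nat.cast_ne_zero] at he he'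
    exact h e e' he he'

theorem val_lt_opow {f : Form} {e : Ordinal} (h : ∀ e', f.coef e' ≠ 0 → e' < e) :
    f.val < ω ^ e := by
  refine CNF.eval_lt (ordCoef_lt f) fun e' he' => h e' ?_
  rwa [Finsupp.mem_support_iff, ordCoef_apply, Nat.cast_ne_zero] at he'

theorem coeff_val (f : Form) (e : Ordinal) : CNF.coeff ω f.val e = f.coef e := by
  rw [Form.val, CNF.coeff_eval one_lt_omega0 (ordCoef_lt f), ordCoef_apply]

/-- The part of a formal sum with exponents satisfying `p`. -/
noncomputable def Form.part (f : Form) (p : Ordinal.{0} → Prop) : Form :=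
  open Classical in toColex ((ofColex f).filter p)

open Classical in
theorem coef_part (f : Form) (p : Ordinal → Prop) (e : Ordinal) :
    (f.part p).coef e = if p e then f.coef e else 0 := by
  change ((ofColex f).filter p) e = _
  rw [Finsupp.filter_apply]
  rfl

theorem of_coef_part_ne_zero {f : Form} {p : Ordinal → Prop} {e : Ordinal}
    (h : (f.part p).coef e ≠ 0) : p e := by
  by_contra hp
  rw [coef_part, if_neg hp] at h
  exact h rfl

theorem eq_of_coef_mono_ne_zero {e e' : Ordinal} {n : ℕ} (h : (mono e n).coef e' ≠ 0) :
    e' = e := by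
  by_contra he
  exact h (coef_mono_of_ne he n)

theorem val_split (f : Form) (i : Ordinal) :
    f.val = (f.part (i < ·)).val + (ω ^ i * f.coef i + (f.part (· < i)).val) := by
  have h : f = f.part (i < ·) + (mono i (f.coef i) + f.part (· < i)) := by
    refine Form.ext fun e => ?_
    rw [coef_add, coef_add, coef_part, coef_part, coef_mono]
    rcases lt_trichotomy e i with h | h | h
    · simp [h, h.not_gt, h.ne]
    · simp [h]
    · simp [h, h.not_gt, h.ne']
  conv_lhs => rw [h]
  rw [val_add, val_add, val_mono]
  · intro e e' he he'
    rw [eq_of_coef_mono_ne_zero he]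
    exact (of_coef_part_ne_zero he').le
  · intro e e' he he'
    refine le_of_lt (lt_of_le_of_lt (b := i) ?_ (of_coef_part_ne_zero he))
    by_contra hlt
    rw [coef_add, coef_mono_of_ne (by rintro rfl; exact hlt le_rfl), zero_add] at he'
    exact hlt (of_coef_part_ne_zero he').le

/-- Above the largest exponent `i` of disagreement the values agree, and the terms below `ω ^ i`
cannot make up for a missing copy of `ω ^ i`. Thus natural sums can be added and compared as forms
and only then turned into ordinals. -/
theorem val_strictMono : StrictMono Form.val := by
  intro f g hfg
  obtain ⟨i, hi, hlt⟩ := Form.lt_iff.1 hfg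
  have h : f.part (i < ·) = g.part (i < ·) := by
    refine Form.ext fun e => ?_
    rw [coef_part, coef_part]
    split_ifs with h
    · exact hi e h
    · rfl
  rw [val_split f i, val_split g i, h, add_lt_add_iff_left]
  refine lt_of_lt_of_le ?_ (le_add_right (a := ω ^ i * (g.coef i : Ordinal)) le_rfl)
  refine opow_mul_add_lt_opow_mul (val_lt_opow fun e' he' => ?_) (by exact_mod_cast hlt)
  rw [coef_part] at he'
  by_contra hh
  simp [hh] at he'

/-! ### Hereditarily bounded ordinals and towers -/

/-- All coefficients of `δ` are below `x`, hereditarily for `k` levels of exponents. -/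
def Bounded : ℕ → ℕ → Ordinal.{0} → Prop
  | 0, _, δ => δ < ω
  | k + 1, x, δ => ∀ e, CNF.coeff ω δ e ≠ 0 → CNF.coeff ω δ e < x ∧ Bounded k x e

theorem bounded_val {k x : ℕ} {f : Form} :
    Bounded (k + 1) x f.val ↔ ∀ e, f.coef e ≠ 0 → f.coef e < x ∧ Bounded k x e := by
  simp only [Bounded, coeff_val, Nat.cast_ne_zero, Nat.cast_lt]

theorem Bounded.mono {k x y : ℕ} {δ : Ordinal} (h : Bounded k x δ) (hxy : x ≤ y) :
    Bounded k y δ := by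
  induction k generalizing δ with
  | zero => exact h
  | succ k ih =>
    intro e he
    exact ⟨(h e he).1.trans_le (by exact_mod_cast hxy), ih (h e he).2⟩

theorem bounded_natCast (k : ℕ) {x i : ℕ} (h : i < x) : Bounded k x i := by
  induction k generalizing i with
  | zero => exact natCast_lt_omega0 i
  | succ k ih =>
    have : (i : Ordinal) = (KetonenSolovay.mono 0 i).val := by simp
    rw [this, bounded_val]
    intro e he
    rw [coef_mono] at he ⊢
    split_ifs at he ⊢ with h0
    · subst h0
      exact ⟨h, by exact_mod_cast ih (i := 0) (by omega)⟩
    · exact absurd rfl he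

/-- The tower `ω ^ ω ^ ... ^ α` of height `d`. -/
noncomputable def tower : ℕ → Ordinal.{0} → Ordinal.{0}
  | 0, α => α
  | d + 1, α => ω ^ tower d α

theorem tower_strictMono (d : ℕ) : StrictMono (tower d) := by
  induction d with
  | zero => exact strictMono_id
  | succ d ih => exact fun a b h => (opow_lt_opow_iff_right one_lt_omega0).2 (ih h)

theorem bounded_opow_mul {k x n : ℕ} {e : Ordinal} (he : Bounded k x e) (hn : n < x) :
    Bounded (k + 1) x (ω ^ e * n) := by
  rw [← val_mono, bounded_val]
  intro e' he'
  rw [coef_mono] at he' ⊢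
  split_ifs at he' ⊢ with h
  · exact ⟨hn, h ▸ he⟩
  · exact absurd rfl he'

theorem bounded_tower {k x : ℕ} {δ : Ordinal} (hx : 1 < x) (h : Bounded k x δ) (d : ℕ) :
    Bounded (k + d) x (tower d δ) := by
  induction d with
  | zero => exact h
  | succ d ih =>
    have := bounded_opow_mul ih hx
    rwa [Nat.cast_one, mul_one] at this

theorem Bounded.of_add {k x n : ℕ} {e δ : Ordinal} (hδ : δ < ω ^ e)
    (h : Bounded (k + 1) x (ω ^ e * n + δ)) : Bounded (k + 1) x δ := by
  rcases Nat.eq_zero_or_pos n with rfl | hn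
  · simpa using h
  intro e' he'
  have hne : e' ≠ e := fun h => he' (h ▸ CNF.coeff_eq_zero_of_lt hδ)
  have := h e'
  rw [CNF.coeff_opow_mul_add one_lt_omega0 (by exact_mod_cast hn.ne') (natCast_lt_omega0 n) hδ,
    Finsupp.add_apply, Finsupp.single_eq_of_ne hne, zero_add] at this
  exact this he'

theorem Bounded.leading {k x : ℕ} {δ : Ordinal} (h : Bounded (k + 1) x δ) (h0 : δ ≠ 0) :
    ∃ e q, q < x ∧ q ≠ 0 ∧ Bounded k x e ∧ ∃ r < ω ^ e, δ = ω ^ e * q + r := by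
  have hlt := div_opow_log_lt δ one_lt_omega0
  obtain ⟨q, hq⟩ := lt_omega0.1 hlt
  have hpos := div_opow_log_pos ω h0
  have hdecomp : δ = ω ^ log ω δ * q + δ % ω ^ log ω δ := by
    rw [← hq, Ordinal.div_add_mod]
  have hr : δ % ω ^ log ω δ < ω ^ log ω δ := mod_lt _ (opow_pos _ omega0_pos).ne'
  have hq0 : q ≠ 0 := by
    rintro rfl
    rw [hq] at hpos
    simp at hpos
  have hc : CNF.coeff ω δ (log ω δ) = q := by
    have : CNF.coeff ω δ = CNF.coeff ω (ω ^ log ω δ * q + δ % ω ^ log ω δ) := by rw [← hdecomp]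
    rw [this, CNF.coeff_opow_mul_add one_lt_omega0 (by exact_mod_cast hq0) (natCast_lt_omega0 q) hr,
      Finsupp.add_apply, Finsupp.single_eq_same, CNF.coeff_eq_zero_of_lt hr, add_zero]
  obtain ⟨h1, h2⟩ := h (log ω δ) (by rw [hc]; exact_mod_cast hq0)
  rw [hc] at h1
  exact ⟨log ω δ, q, by exact_mod_cast h1, hq0, h2, _, hr, hdecomp⟩

/-! ### Domination by the fundamental sequence -/

theorem exists_eq_oadd_of_lt_omega0 {o : ONote} (ho : o.NF) (h : o.repr < ω) (h0 : o ≠ 0) :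
    ∃ n : ℕ, o = ONote.oadd 0 n.succPNat 0 := by
  cases o with
  | zero => exact absurd rfl h0
  | oadd e n a =>
    have he : e = 0 := by
      by_contra he
      have h1 : ω ≤ ω ^ e.repr := left_le_opow _ (pos_iff_ne_zero.2 fun h' => he ?_)
      · exact absurd ((h1.trans (ONote.omega0_le_oadd e n a)).trans_lt h) (lt_irrefl _)
      · have := ho.fst
        exact ONote.repr_inj.1 (by simpa using h')
    subst he
    rw [ho.zero_of_zero rfl]
    exact ⟨n.natPred, by simp⟩

/-- The fundamental sequence dominates bounded ordinals. -/
theorem le_fundNote {x : ℕ} (hx : 0 < x) {o : ONote} (ho : o.NF) {k : ℕ}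
    (hk : o.repr < tower k ω) {δ : Ordinal} (hB : Bounded k x δ) (hδ : δ < o.repr) :
    δ ≤ (fundNote o x).repr ∧ (predOpt o = none → δ < (fundNote o x).repr) := by
  induction o generalizing k δ with
  | zero => simp at hδ
  | oadd e n a ihe iha =>
    cases k with
    -- Below `ω` the step is the predecessor for every `x`, so `Bounded 0` need only ask for
    -- finiteness. In return `o` must lie below a tower of height `k`.
    | zero =>
      obtain ⟨m, hm⟩ := exists_eq_oadd_of_lt_omega0 ho hk (by simp)
      rw [hm] at hδ ⊢
      refine ⟨?_, by simp [predOpt]⟩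
      have h1 : (fundNote (ONote.oadd 0 m.succPNat 0) x).repr = m := by
        simp [fundNote, repr_lead]
      rw [h1]
      simpa [ONote.repr, Order.lt_succ_iff, Order.lt_add_one_iff] using hδ
    | succ k =>
      have hek : e.repr < tower k ω :=
        (opow_lt_opow_iff_right one_lt_omega0).1 ((ONote.omega0_le_oadd e n a).trans_lt hk)
      rw [fundNote]
      have hn : (n : Ordinal) = (n.natPred : ℕ) + 1 := by
        exact_mod_cast (PNat.natPred_add_one n).symm
      split_ifs with ha he
      · subst ha he
        have hpred : predOpt (ONote.oadd 0 n 0) ≠ none := by simp [predOpt]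
        refine ⟨?_, fun h => absurd h hpred⟩
        simp only [ONote.repr, opow_zero, one_mul, add_zero] at hδ
        rw [hn, Order.lt_add_one_iff] at hδ
        simpa [repr_lead] using hδ
      -- Only the last copy of `ω ^ e` changes; once `δ` passes the other copies, its remainder is
      -- still bounded.
      · have key : ∀ r : ONote, (∀ δ' < ω ^ e.repr, Bounded (k + 1) x δ' → δ' < r.repr) →
            δ < (lead e n.natPred r).repr := by
          intro r hr
          rw [repr_lead]
          rcases lt_or_ge δ (ω ^ e.repr * (n.natPred : ℕ)) with h | h
          · exact h.trans_le (le_add_right le_rfl)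
          · obtain ⟨δ', rfl⟩ := exists_add_of_le h
            rw [add_lt_add_iff_left]
            have hδ' : δ' < ω ^ e.repr := by
              subst ha
              simp only [ONote.repr, add_zero] at hδ
              rwa [hn, mul_add, mul_one, add_lt_add_iff_left] at hδ
            exact hr δ' hδ' (hB.of_add hδ')
        suffices h : δ < (lead e n.natPred (match predOpt e with
            | some b => lead b x 0
            | none => ONote.oadd (fundNote e x) 1 0)).repr from ⟨h.le, fun _ => h⟩
        apply key
        intro δ' hδ' hB'
        split
        · next b hb =>
          obtain ⟨hbn, hbr⟩ := predOpt_spec ho.fst hb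
          rw [repr_lead, ONote.repr_zero, add_zero]
          rcases eq_or_ne δ' 0 with rfl | h0
          · exact mul_pos (opow_pos _ omega0_pos) (by exact_mod_cast hx)
          obtain ⟨e', q, hq, hq0, -, r, hr, rfl⟩ := hB'.leading h0
          have he' : e' ≤ b.repr := by
            rw [hbr] at hδ'
            rw [← Order.lt_add_one_iff, ← opow_lt_opow_iff_right one_lt_omega0]
            refine lt_of_le_of_lt ?_ hδ'
            refine le_trans ?_ (le_add_right (a := ω ^ e' * (q : Ordinal)) le_rfl)
            exact le_mul_left _ (by exact_mod_cast Nat.pos_of_ne_zero hq0)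
          rcases he'.lt_or_eq with h | h
          · refine (opow_mul_add_lt_opow (natCast_lt_omega0 q) hr h).trans_le ?_
            exact le_mul_left _ (by exact_mod_cast hx)
          · subst h
            exact opow_mul_add_lt_opow_mul hr (by exact_mod_cast hq)
        · next hnone =>
          simp only [ONote.repr, add_zero, PNat.one_coe, Nat.cast_one, mul_one]
          rcases eq_or_ne δ' 0 with rfl | h0
          · exact opow_pos _ omega0_pos
          obtain ⟨e', q, hq, hq0, he', r, hr, rfl⟩ := hB'.leading h0
          refine opow_mul_add_lt_opow (natCast_lt_omega0 q) hr ?_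
          -- The strict half of the induction hypothesis is essential: an exponent equal to `e[x]`
          -- would not give a value below `ω ^ (e[x])`.
          refine (ihe ho.fst hek he' ?_).2 hnone
          rw [← opow_lt_opow_iff_right one_lt_omega0]
          refine lt_of_le_of_lt ?_ hδ'
          refine le_trans ?_ (le_add_right (a := ω ^ e' * (q : Ordinal)) le_rfl)
          exact le_mul_left _ (by exact_mod_cast Nat.pos_of_ne_zero hq0)
      · have he : e ≠ 0 := fun he => ha (ho.zero_of_zero he)
        have hpred : predOpt (ONote.oadd e n a) = none → predOpt a = none := by
          rw [predOpt, if_neg he, Option.map_eq_none_iff]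
          exact id
        simp only [ONote.repr] at hδ hk ⊢
        rcases lt_or_ge δ (ω ^ e.repr * (n : ℕ)) with h | h
        · exact ⟨h.le.trans (le_add_right le_rfl), fun _ => h.trans_le (le_add_right le_rfl)⟩
        · obtain ⟨δ', rfl⟩ := exists_add_of_le h
          rw [add_lt_add_iff_left] at hδ
          have hδ' : δ' < ω ^ e.repr := hδ.trans ho.snd'.repr_lt
          have hak : a.repr < tower (k + 1) ω := (le_add_left le_rfl).trans_lt hk
          obtain ⟨h1, h2⟩ := iha ho.snd hak (hB.of_add hδ') hδ
          exact ⟨by gcongr, fun hp => (add_lt_add_iff_left _).2 (h2 (hpred hp))⟩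

/-! ### The descent along `X`, indexed by all natural numbers -/

/-- The value of `α[x₀][x₁]...` after all elements of `X` below `n` have been used. -/
def descent (α : NONote) (X : Finset ℕ) : ℕ → NONote
  | 0 => α
  | n + 1 => if n ∈ X then fund (descent α X n) n else descent α X n

theorem descent_eq_foldl (α : NONote) (X : Finset ℕ) (n : ℕ) :
    descent α X n = ((X.filter (· < n)).sort (· ≤ ·)).foldl fund α := by
  induction n with
  | zero => simp [descent]
  | succ n ih =>
    rw [descent]
    split_ifs with h
    · have : (X.filter (· < n + 1)).sort (· ≤ ·) = (X.filter (· < n)).sort (· ≤ ·) ++ [n] := by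
        refine List.Perm.eq_of_pairwise' (r := (· ≤ ·)) (Finset.pairwise_sort _ _) ?_ ?_
        · rw [List.pairwise_append]
          refine ⟨Finset.pairwise_sort _ _, by simp, fun a ha b hb => ?_⟩
          simp only [mem_sort, mem_filter] at ha
          simp only [List.mem_singleton] at hb
          omega
        · rw [List.perm_ext_iff_of_nodup (Finset.sort_nodup _ _)]
          · intro a
            simp only [mem_sort, mem_filter, List.mem_append, List.mem_singleton]
            constructor
            · rintro ⟨h1, h2⟩
              rcases Nat.lt_succ_iff_lt_or_eq.1 h2 with h3 | h3
              · exact Or.inl ⟨h1, h3⟩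
              · exact Or.inr h3
            · rintro (⟨h1, h2⟩ | rfl)
              · exact ⟨h1, by omega⟩
              · exact ⟨h, by omega⟩
          · rw [List.nodup_append]
            refine ⟨Finset.sort_nodup _ _, by simp, fun a ha b hb => ?_⟩
            simp only [mem_sort, mem_filter] at ha
            simp only [List.mem_singleton] at hb
            omega
      rw [this, List.foldl_append, ← ih]
      rfl
    · rw [ih]
      congr 2
      refine filter_congr fun a ha => ?_
      have : a ≠ n := fun h' => h (h' ▸ ha)
      omega

theorem IsLarge.exists_descent_eq_zero {α : NONote} {X : Finset ℕ} (h : IsLarge α X) :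
    ∃ n, descent α X n = 0 := by
  refine ⟨X.sup id + 1, ?_⟩
  rw [descent_eq_foldl, filter_true_of_mem]
  · exact h
  · exact fun x hx => Nat.lt_succ_of_le (le_sup (f := id) hx)

theorem repr_fund_le (α : NONote) (x : ℕ) : (fund α x).repr ≤ α.repr := by
  rcases eq_or_ne α.1 0 with h | h
  · have : (fund α x).repr = 0 := by
      change (fundNote α.1 x).repr = 0
      rw [h]
      rfl
    rw [this]
    exact zero_le
  · exact ((fundNote_spec α.2 x).2 h).le

theorem descent_antitone (α : NONote) (X : Finset ℕ) :
    Antitone fun n => (descent α X n).repr := by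
  refine antitone_nat_of_succ_le fun n => ?_
  rw [descent]
  split_ifs
  · exact repr_fund_le _ _
  · exact le_rfl

/-- If `n ∉ X` nothing changes, otherwise `le_fundNote` applies. The estimate therefore does not
depend on the gaps of `X`. -/
theorem le_descent_succ {α : NONote} {X : Finset ℕ} {k n : ℕ} (hα : α.repr < tower k ω)
    (hn : 0 < n) {δ : Ordinal} (hB : Bounded k n δ) (h : δ < (descent α X n).repr) :
    δ ≤ (descent α X (n + 1)).repr := by
  rw [descent]
  split_ifs
  · have hlt := (descent_antitone α X (Nat.zero_le n)).trans_lt hα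
    exact (le_fundNote hn (descent α X n).2 hlt hB h).1
  · exact h.le

/-! ### Paying for fast-growing jumps in time -/

/-- The fast-growing hierarchy. -/
def grow : ℕ → ℕ → ℕ
  | 0, n => n + 1
  | j + 1, n => (grow j)^[n] n

theorem le_grow (j n : ℕ) : n ≤ grow j n := by
  induction j generalizing n with
  | zero => exact Nat.le_succ n
  | succ j ih => exact Function.id_le_iterate_of_id_le ih n n

theorem lt_grow (j : ℕ) {n : ℕ} (hn : 0 < n) : n < grow j n := by
  induction j generalizing n with
  | zero => exact Nat.lt_succ_self n
  | succ j ih =>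
    obtain ⟨m, rfl⟩ := Nat.exists_eq_succ_of_ne_zero hn.ne'
    rw [grow, Function.iterate_succ_apply]
    exact (ih hn).trans_le (Function.id_le_iterate_of_id_le (le_grow j) _ _)

theorem mono_lt_mono {e e' : Ordinal} {m n : ℕ} (h : e < e') (hn : 0 < n) :
    mono e m < mono e' n := by
  refine Form.lt_iff.2 ⟨e', fun i hi => ?_, ?_⟩
  · rw [coef_mono_of_ne (h.trans hi).ne', coef_mono_of_ne hi.ne']
  · rwa [coef_mono_of_ne h.ne', coef_mono_same]

theorem mono_add (e : Ordinal) (m n : ℕ) : mono e (m + n) = mono e m + mono e n := by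
  refine Form.ext fun e' => ?_
  rw [coef_add, coef_mono, coef_mono, coef_mono]
  split_ifs <;> rfl

theorem mono_pos (e : Ordinal) {n : ℕ} (hn : 0 < n) : 0 < mono e n :=
  Form.lt_iff.2 ⟨e, fun i hi => by rw [coef_zero, coef_mono_of_ne hi.ne'], by simpa using hn⟩

/-- The summand `ω ^ j` buys time: at time `n` it is exchanged for `n` copies of `ω ^ (j - 1)`, each
paying for one application of `grow (j - 1)`. The conditions `j ≤ 3 ≤ n` keep the finite exponents
introduced here below the current time. -/
theorem le_descent_grow {α : NONote} {X : Finset ℕ} {k : ℕ} (hα : α.repr < tower (k + 1) ω)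
    {j : ℕ} (hj : j ≤ 3) {f : Form} {n : ℕ} (hn : 3 ≤ n)
    (hB : ∀ e, f.coef e ≠ 0 → f.coef e < n ∧ Bounded k n e)
    (hlow : ∀ e, f.coef e ≠ 0 → (j : Ordinal) ≤ e)
    (h : (f + mono j 1).val ≤ (descent α X n).repr) :
    f.val ≤ (descent α X (grow j n)).repr := by
  induction j generalizing f n with
  | zero =>
    refine le_descent_succ hα (by omega) (bounded_val.2 hB) (lt_of_lt_of_le ?_ h)
    exact val_strictMono (lt_add_of_pos_right _ (mono_pos _ one_pos))
  | succ j ih =>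
    have key : ∀ a m, n ≤ m → a ≤ n → (f + mono j a).val ≤ (descent α X m).repr →
        f.val ≤ (descent α X ((grow j)^[a] m)).repr := by
      intro a
      induction a with
      | zero =>
        intro m _ _ h
        have : mono j 0 = 0 := Form.ext fun e => by rw [coef_mono]; simp
        simpa [this] using h
      | succ a iha =>
        intro m hm ha h
        rw [Function.iterate_succ_apply]
        refine iha _ (hm.trans (le_grow j m)) (by omega) ?_
        -- Since `f` has no term `ω ^ j`, that coefficient in the new form is just the number `a` of
        -- remaining copies, which is below `m`.
        have hfj : f.coef (j : Ordinal) = 0 := by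
          by_contra h0
          have := hlow _ h0
          norm_cast at this
          omega
        refine ih (by omega) (by omega) (fun e he => ?_) (fun e he => ?_) ?_
        · rw [coef_add, coef_mono] at he ⊢
          split_ifs at he ⊢ with hej
          · subst hej
            rw [hfj]
            exact ⟨by omega, bounded_natCast k (by omega)⟩
          · obtain ⟨h1, h2⟩ := hB e (by simpa using he)
            exact ⟨by omega, h2.mono hm⟩
        · rw [coef_add, coef_mono] at he
          split_ifs at he with hej
          · exact hej.ge
          · refine le_trans ?_ (hlow e (by simpa using he))
            exact_mod_cast Nat.le_succ j
        · rwa [add_assoc, ← mono_add]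
    refine key n n le_rfl le_rfl (le_trans ?_ h)
    refine (val_strictMono (add_lt_add_right (mono_lt_mono ?_ one_pos) f)).le
    exact_mod_cast Nat.lt_succ_self j

/-- A descending sequence of formal sums, strictly decreasing along `X`, whose coefficients grow
slowly enough, keeps the descent from `α` along `X` away from zero. -/
theorem descent_pos {α : NONote} {X : Finset ℕ} {k : ℕ} (hα : α.repr < tower (k + 1) ω)
    {v : ℕ → Form} {b : ℕ → ℕ} {T : ℕ} (hT : 3 ≤ T)
    (hv : ∀ x ∈ X, ∀ w ≤ x, v (x + 1) < v w)
    (hlow : ∀ n e, (v n).coef e ≠ 0 → 3 ≤ e)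
    (hB : ∀ n e, (v n).coef e ≠ 0 → (v n).coef e < b n ∧ Bounded k (b n) e)
    (hb : ∀ x, T ≤ x → b (x + 1) ≤ grow 3 x) (hb0 : b 0 ≤ T)
    (hstart : (v 0 + mono 3 1).val ≤ (descent α X T).repr) (N : ℕ) :
    0 < (descent α X N).repr := by
  -- Here `y` is the time of the descent and `w` the stage of `v`, which may lag behind; the
  -- invariant is that `v w` plus the reserve `ω ^ 3` is still dominated.
  have key : ∀ m y w, N - y ≤ m → w ≤ y → T ≤ y → b w ≤ y →
      (v w + mono 3 1).val ≤ (descent α X y).repr → 0 < (descent α X N).repr := by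
    intro m
    induction m with
    | zero =>
      intro y w hm _ _ _ h
      refine lt_of_lt_of_le ?_ (h.trans (descent_antitone α X (show N ≤ y by omega)))
      rw [← val_zero]
      exact val_strictMono (add_pos_of_nonneg_of_pos bot_le (mono_pos _ one_pos))
    | succ m ih =>
      intro y w hm hwy hTy hbw h
      by_cases hy : y ∈ X
      · have hlt := lt_grow 3 (show 0 < y by omega)
        -- The reserve is spent to reach time `grow 3 y`, where the coefficients of `v (y + 1)` are
        -- allowed. Elements of `X` passed on the way can only lower `v` and need not be tracked.
        refine ih (grow 3 y) (y + 1) (by omega) hlt (by omega) (hb y hTy) ?_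
        refine le_trans ?_ (le_descent_grow hα le_rfl (hT.trans hTy) (f := v w) (fun e he => ?_)
          (fun e he => by exact_mod_cast hlow w e he) (by exact_mod_cast h))
        -- All exponents are at least 3, so the drop from `v w` to `v (y + 1)` is worth at least one
        -- `ω ^ 3`, which restores the reserve.
        · refine val_strictMono.monotone ?_
          obtain ⟨i, hi, hlt⟩ := Form.lt_iff.1 (hv y hy w hwy)
          have h3 : 3 ≤ i := hlow w i (by omega)
          rcases h3.lt_or_eq with h3 | h3
          · refine le_of_lt (Form.lt_iff.2 ⟨i, fun e he => ?_, ?_⟩)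
            · rw [coef_add, coef_mono_of_ne (h3.trans he).ne', add_zero, hi e he]
            · rwa [coef_add, coef_mono_of_ne h3.ne', add_zero]
          · subst h3
            rcases (Nat.succ_le_of_lt hlt).lt_or_eq with h4 | h4
            · refine le_of_lt (Form.lt_iff.2 ⟨3, fun e he => ?_, ?_⟩)
              · rw [coef_add, coef_mono_of_ne he.ne', add_zero, hi e he]
              · rwa [coef_add, coef_mono_same]
            · refine le_of_eq (Form.ext fun e => ?_)
              rcases lt_trichotomy e 3 with he | he | he
              · rw [coef_add, coef_mono_of_ne he.ne, add_zero]
                have z : ∀ n, (v n).coef e = 0 := fun n => by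
                  by_contra h0
                  exact absurd (hlow n e h0) he.not_ge
                rw [z, z]
              · subst he
                rwa [coef_add, coef_mono_same]
              · rw [coef_add, coef_mono_of_ne he.ne', add_zero, hi e he]
        · obtain ⟨h1, h2⟩ := hB w e he
          exact ⟨by omega, h2.mono hbw⟩
      · refine ih (y + 1) w (by omega) (by omega) (by omega) (by omega) ?_
        rwa [descent, if_neg hy]
  exact key N T 0 (by omega) (by omega) le_rfl hb0 hstart

/-! ### Colourings and the slots of the Erdős–Rado tree -/

/-- Colourings of all finite sets; only the restriction to sets of a fixed size matters. -/
abbrev TotalColouring : Type := Finset ℕ → ℕ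

noncomputable instance : DecidableEq TotalColouring := Classical.decEq _

/-- On the `D`-element subsets of `X`, the colouring `C` takes values below `c` and has no
homogeneous set `H` with `|H| > min H`. -/
structure Avoids (D c : ℕ) (C : TotalColouring) (X : Finset ℕ) : Prop where
  colour_lt : ∀ t ⊆ X, t.card = D → C t < c
  card_le : ∀ H ⊆ X, ∀ h : H.Nonempty,
    (∀ s t, s ⊆ H → t ⊆ H → s.card = D → t.card = D → C s = C t) → H.card ≤ H.min' h

theorem Avoids.subset {D c : ℕ} {C : TotalColouring} {X Y : Finset ℕ} (h : Avoids D c C X)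
    (hY : Y ⊆ X) : Avoids D c C Y :=
  ⟨fun t ht => h.colour_lt t (ht.trans hY), fun H hH => h.card_le H (hH.trans hY)⟩

theorem Avoids.congr {D c : ℕ} {C C' : TotalColouring} {X : Finset ℕ} (h : Avoids D c C X)
    (hC : ∀ t ⊆ X, t.card = D → C' t = C t) : Avoids D c C' X := by
  refine ⟨fun t ht hD => (hC t ht hD).symm ▸ h.colour_lt t ht hD, fun H hH hne hom => ?_⟩
  refine h.card_le H hH hne fun s t hs ht hsD htD => ?_
  rw [← hC s (hs.trans hH) hsD, ← hC t (ht.trans hH) htD]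
  exact hom s t hs ht hsD htD

/-- The `D`-element subsets of `A ∪ {x}` that contain `x`. -/
def newTuples (D : ℕ) (A : Finset ℕ) (x : ℕ) : Finset (Finset ℕ) :=
  (powersetCard D (insert x A)).filter (x ∈ ·)

theorem mem_newTuples {D : ℕ} {A : Finset ℕ} {x : ℕ} {t : Finset ℕ} :
    t ∈ newTuples D A x ↔ t ⊆ insert x A ∧ t.card = D ∧ x ∈ t := by
  simp [newTuples, and_assoc]

theorem card_newTuples_le (D : ℕ) (A : Finset ℕ) (x : ℕ) :
    (newTuples D A x).card ≤ 2 ^ (insert x A).card := by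
  rw [← card_powerset]
  refine card_le_card fun t ht => ?_
  exact mem_powerset.2 (mem_newTuples.1 ht).1

/-- The ways to recolour the new tuples by colours below `c`. -/
noncomputable def extensions (D c : ℕ) (C : TotalColouring) (A : Finset ℕ) (x : ℕ) :
    Finset TotalColouring :=
  ((newTuples D A x).pi fun _ => range c).image
    fun τ t => if h : t ∈ newTuples D A x then τ t h else C t

theorem mem_extensions {D c : ℕ} {C C' : TotalColouring} {A : Finset ℕ} {x : ℕ} :
    C' ∈ extensions D c C A x ↔
      (∀ t ∉ newTuples D A x, C' t = C t) ∧ ∀ t ∈ newTuples D A x, C' t < c := by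
  simp only [extensions, mem_image, Finset.mem_pi, mem_range]
  constructor
  · rintro ⟨τ, hτ, rfl⟩
    refine ⟨fun t ht => by simp [ht], fun t ht => ?_⟩
    simpa [ht] using hτ t ht
  · rintro ⟨h1, h2⟩
    refine ⟨fun t _ => C' t, h2, funext fun t => ?_⟩
    split_ifs with h
    · rfl
    · exact (h1 t h).symm

theorem card_extensions_le (D c : ℕ) (C : TotalColouring) (A : Finset ℕ) (x : ℕ) :
    (extensions D c C A x).card ≤ c ^ (newTuples D A x).card := by
  refine card_image_le.trans ?_
  rw [card_pi]
  simp

/-- A branch of the Erdős–Rado tree, with the colouring that later elements induce on it. -/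
abbrev Slot : Type := Finset ℕ × TotalColouring

open Classical in
/-- The slots created when `x` is put into the slot `s`. -/
noncomputable def children (D c : ℕ) (s : Slot) (x : ℕ) : Multiset Slot :=
  ((extensions D c s.2 s.1 x).filter fun C' => Avoids D c C' (insert x s.1)).val.map
    fun C' => (insert x s.1, C')

theorem mem_children {D c : ℕ} {s s' : Slot} {x : ℕ} :
    s' ∈ children D c s x ↔ s'.1 = insert x s.1 ∧ s'.2 ∈ extensions D c s.2 s.1 x ∧
      Avoids D c s'.2 s'.1 := by
  obtain ⟨A, C⟩ := s'
  simp only [children, Multiset.mem_map, mem_val, mem_filter, Prod.mk.injEq]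
  constructor
  · rintro ⟨C', ⟨h1, h2⟩, rfl, rfl⟩
    exact ⟨rfl, h1, h2⟩
  · rintro ⟨rfl, h1, h2⟩
    exact ⟨C, ⟨h1, h2⟩, rfl, rfl⟩

theorem card_children_le (D c : ℕ) (s : Slot) (x : ℕ) :
    Multiset.card (children D c s x) ≤ c ^ (newTuples D s.1 x).card := by
  classical
  rw [children, Multiset.card_map, card_val]
  exact (card_filter_le _ _).trans (card_extensions_le _ _ _ _ _)

/-- The element `z` induces the colouring of the slot `s`. -/
def Lands (D : ℕ) (C : TotalColouring) (z : ℕ) (s : Slot) : Prop :=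
  ∀ t ⊆ s.1, t.card = D → C (insert z t) = s.2 t

open Classical in
/-- Replace a slot that satisfies `P` by its children. -/
noncomputable def replaceSlot (D c z : ℕ) (S : Multiset Slot) (P : Slot → Prop) : Multiset Slot :=
  if h : ∃ s, P s then S.erase h.choose + children D c h.choose z else S

/-- The slots of the Erdős–Rado tree of a colouring of `(D + 1)`-tuples; the elements are listed
in decreasing order. -/
noncomputable def slots (D c : ℕ) (C : TotalColouring) : List ℕ → Multiset Slot
  | [] => {(∅, fun _ => 0)}
  | x :: l => replaceSlot D c x (slots D c C l) fun s => s ∈ slots D c C l ∧ Lands D C x s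

theorem slots_cons_cases (D c : ℕ) (C : TotalColouring) (x : ℕ) (l : List ℕ) :
    (∃ s ∈ slots D c C l, Lands D C x s ∧
      slots D c C (x :: l) = (slots D c C l).erase s + children D c s x) ∨
    ((¬ ∃ s ∈ slots D c C l, Lands D C x s) ∧ slots D c C (x :: l) = slots D c C l) := by
  by_cases h : ∃ s, s ∈ slots D c C l ∧ Lands D C x s
  · refine Or.inl ⟨h.choose, h.choose_spec.1, h.choose_spec.2, ?_⟩
    rw [slots, replaceSlot, dif_pos h]
  · refine Or.inr ⟨h, ?_⟩
    rw [slots, replaceSlot, dif_neg h]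

/-- The last clause is end-homogeneity: a tuple's colour does not depend on its largest element. It
survives insertion because `x` landed in the slot and only tuples containing the new maximum are
recoloured. -/
theorem slots_spec {D c : ℕ} (hD : 0 < D) (C : TotalColouring) {l : List ℕ}
    (hl : l.Pairwise (· > ·)) {s : Slot} (hs : s ∈ slots D c C l) :
    s.1 ⊆ l.toFinset ∧ Avoids D c s.2 s.1 ∧
      ∀ t ⊆ s.1, t.card = D → ∀ a ∈ s.1, (∀ b ∈ t, b < a) → C (insert a t) = s.2 t := by
  induction l generalizing s with
  | nil =>
    rw [slots, Multiset.mem_singleton] at hs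
    subst hs
    refine ⟨by simp, ⟨fun t ht h => ?_, fun H hH h => ?_⟩, by simp⟩
    · rw [subset_empty.1 ht] at h
      simp at h
      omega
    · rw [subset_empty.1 hH] at h
      simp at h
  | cons x l ih =>
    rw [List.pairwise_cons] at hl
    have old : ∀ s ∈ slots D c C l, s.1 ⊆ (x :: l).toFinset ∧ Avoids D c s.2 s.1 ∧
        ∀ t ⊆ s.1, t.card = D → ∀ a ∈ s.1, (∀ b ∈ t, b < a) → C (insert a t) = s.2 t := by
      intro s hs
      obtain ⟨h1, h2⟩ := ih hl.2 hs
      exact ⟨h1.trans (by simp [subset_insert]), h2⟩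
    rcases slots_cons_cases D c C x l with ⟨p, hp, hland, heq⟩ | ⟨-, heq⟩
    · rw [heq, Multiset.mem_add] at hs
      rcases hs with hs | hs
      · exact old s (Multiset.mem_of_mem_erase hs)
      · obtain ⟨h1, h2, h3⟩ := mem_children.1 hs
        obtain ⟨p1, -, p3⟩ := ih hl.2 hp
        refine ⟨?_, h3, ?_⟩
        · rw [h1, List.toFinset_cons]
          exact insert_subset_insert _ p1
        · intro t ht hcard a ha hlt
          rw [h1] at ht ha
          have hx : ∀ b ∈ p.1, b < x := fun b hb => hl.1 b (by simpa using p1 hb)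
          have hxt : x ∉ t := by
            intro hxt
            have := hlt x hxt
            rcases mem_insert.1 ha with rfl | ha
            · exact lt_irrefl _ this
            · exact lt_asymm this (hx a ha)
          have htp : t ⊆ p.1 := (subset_insert_iff_of_notMem hxt).1 ht
          rw [(mem_extensions.1 h2).1 t fun h => hxt (mem_newTuples.1 h).2.2]
          rcases mem_insert.1 ha with rfl | ha
          · exact hland t htp hcard
          · exact p3 t htp hcard a ha hlt
    · rw [heq] at hs
      exact old s hs

/-- The landing predicates coincide, hence so do the arbitrary choices of slots. This is needed
because a child's colouring differs from its parent's off the old branch. -/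
theorem slots_congr {D c : ℕ} (hD : 0 < D) {C C' : TotalColouring} {l : List ℕ}
    (hl : l.Pairwise (· > ·)) (h : ∀ t ⊆ l.toFinset, t.card = D + 1 → C t = C' t) :
    slots D c C l = slots D c C' l := by
  induction l with
  | nil => rfl
  | cons x l ih =>
    have hl' := List.pairwise_cons.1 hl
    have h' := ih hl'.2 fun t ht => h t (ht.trans (by simp [subset_insert]))
    rw [slots, slots, ← h']
    congr 1
    funext s
    refine propext (and_congr_right fun hs => forall_congr' fun t => forall_congr' fun ht =>
      forall_congr' fun hcard => ?_)
    have hsub := (slots_spec hD C hl'.2 hs).1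
    have hx : x ∉ t := fun hx => lt_irrefl x (hl'.1 x (by simpa using hsub (ht hx)))
    rw [h (insert x t)]
    · rw [List.toFinset_cons]
      exact insert_subset_insert _ (ht.trans hsub)
    · rw [card_insert_of_notMem hx, hcard]

/-- A colouring of `D`-tuples induced by a later element on an end-homogeneous set inherits
the avoidance of large homogeneous sets. -/
theorem Avoids.induced {D c : ℕ} {C C' : TotalColouring} {X A : Finset ℕ} {z : ℕ}
    (h : Avoids (D + 1) c C X) (hz : z ∈ X) (hA : A ⊆ X) (hAz : ∀ a ∈ A, a < z)
    (hland : Lands D C z (A, C'))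
    (hend : ∀ t ⊆ A, t.card = D → ∀ a ∈ A, (∀ b ∈ t, b < a) → C (insert a t) = C' t) :
    Avoids D c C' A := by
  have hzn : ∀ t ⊆ A, z ∉ t := fun t ht hzt => lt_irrefl z (hAz z (ht hzt))
  refine ⟨fun t ht hcard => ?_, fun H hH hne hom => ?_⟩
  · have : C (insert z t) = C' t := hland t ht hcard
    rw [← this]
    refine h.colour_lt _ (insert_subset hz (ht.trans hA)) ?_
    rw [card_insert_of_notMem (hzn t ht), hcard]
  -- By landing and end-homogeneity, deleting the maximum turns `C` into `C'`; so `insert z H` is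
  -- homogeneous for `C` when `H` is for `C'`.
  · have hdown : ∀ t ⊆ insert z H, t.card = D + 1 → ∃ t' ⊆ H, t'.card = D ∧ C t = C' t' := by
      intro t ht hcard
      have htne : t.Nonempty := card_pos.1 (by omega)
      have hmax := max'_mem t htne
      have hlt : ∀ b ∈ t.erase (t.max' htne), b < t.max' htne := fun b hb =>
        lt_of_le_of_ne (le_max' t b (mem_of_mem_erase hb)) (ne_of_mem_erase hb)
      have hmz : t.max' htne ≤ z := by
        rcases mem_insert.1 (ht hmax) with h1 | h1
        · exact h1.le
        · exact (hAz _ (hH h1)).le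
      have hsub : t.erase (t.max' htne) ⊆ H := by
        intro b hb
        rcases mem_insert.1 (ht (mem_of_mem_erase hb)) with h1 | h1
        · exact absurd ((hlt b hb).trans_le hmz) (by rw [h1]; exact lt_irrefl z)
        · exact h1
      have hcard' : (t.erase (t.max' htne)).card = D := by
        rw [card_erase_of_mem hmax, hcard]; rfl
      refine ⟨_, hsub, hcard', ?_⟩
      have hins : t = insert (t.max' htne) (t.erase (t.max' htne)) := (insert_erase hmax).symm
      conv_lhs => rw [hins]
      rcases mem_insert.1 (ht hmax) with h1 | h1
      · rw [h1]
        rw [h1] at hsub hcard'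
        exact hland _ (hsub.trans hH) hcard'
      · exact hend _ (hsub.trans hH) hcard' _ (hH h1) hlt
    have hle := h.card_le (insert z H) (insert_subset hz (hH.trans hA)) (insert_nonempty z H) <| by
      intro s t hs ht hsD htD
      obtain ⟨s', hs', hs'D, hs''⟩ := hdown s hs hsD
      obtain ⟨t', ht', ht'D, ht''⟩ := hdown t ht htD
      rw [hs'', ht'']
      exact hom s' t' hs' ht' hs'D ht'D
    rw [card_insert_of_notMem (hzn H hH)] at hle
    exact (Nat.le_succ _).trans (hle.trans (min'_subset hne (subset_insert z H)))

/-- If `x` has just filled the slot of `z`, the colouring that `z` induces on the longer branch is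
one of the extensions, and `Avoids.induced` shows that it was not filtered out. -/
theorem exists_lands {D c : ℕ} (hD : 0 < D) {C : TotalColouring} {l : List ℕ}
    (hl : l.Pairwise (· > ·)) {z : ℕ} (hz : ∀ a ∈ l, a < z)
    (h : Avoids (D + 1) c C (insert z l.toFinset)) : ∃ s ∈ slots D c C l, Lands D C z s := by
  induction l with
  | nil =>
    refine ⟨(∅, fun _ => 0), by simp [slots], fun t ht hcard => ?_⟩
    rw [subset_empty.1 ht] at hcard
    simp at hcard
    omega
  | cons x l ih =>
    have hl' := List.pairwise_cons.1 hl
    obtain ⟨s, hs, hland⟩ := ih hl'.2 (fun a ha => hz a (List.mem_cons_of_mem x ha))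
      (h.subset (insert_subset_insert z (by simp [subset_insert])))
    rcases slots_cons_cases D c C x l with ⟨p, hp, hpland, heq⟩ | ⟨-, heq⟩
    · by_cases hsp : s = p
      · subst hsp
        obtain ⟨h1, h2, h3⟩ := slots_spec hD C hl'.2 hs
        have hzx : x < z := hz x (by simp)
        have hsz : ∀ a ∈ insert x s.1, a < z := by
          intro a ha
          rcases mem_insert.1 ha with rfl | ha
          · exact hzx
          · exact hz a (List.mem_cons_of_mem _ (by simpa using h1 ha))
        have hsub : insert x s.1 ⊆ insert z (x :: l).toFinset := by
          rw [List.toFinset_cons]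
          exact (insert_subset_insert x h1).trans (subset_insert z _)
        set C' : TotalColouring := fun t =>
          if t ∈ newTuples D s.1 x then C (insert z t) else s.2 t with hC'
        have hland' : Lands D C z (insert x s.1, C') := by
          intro t ht hcard
          simp only [hC']
          split_ifs with hn
          · rfl
          · refine hland t ((subset_insert_iff_of_notMem fun hx => hn ?_).1 ht) hcard
            exact mem_newTuples.2 ⟨ht, hcard, hx⟩
        have hmem : C' ∈ extensions D c s.2 s.1 x := by
          refine mem_extensions.2 ⟨fun t ht => if_neg ht, fun t ht => ?_⟩
          simp only [hC', if_pos ht]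
          obtain ⟨ht1, ht2, -⟩ := mem_newTuples.1 ht
          refine h.colour_lt _ (insert_subset (mem_insert_self _ _) (ht1.trans hsub)) ?_
          rw [card_insert_of_notMem fun hzt => lt_irrefl z (hsz z (ht1 hzt)), ht2]
        refine ⟨(insert x s.1, C'), ?_, hland'⟩
        rw [heq, Multiset.mem_add]
        refine Or.inr (mem_children.2 ⟨rfl, hmem, ?_⟩)
        refine h.induced (mem_insert_self _ _) hsub hsz hland' ?_
        intro t ht hcard a ha hlt
        have hsx : ∀ b ∈ s.1, b < x := fun b hb => hl'.1 b (by simpa using h1 hb)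
        have hxt : x ∉ t := by
          intro hxt
          have := hlt x hxt
          rcases mem_insert.1 ha with rfl | ha
          · exact lt_irrefl _ this
          · exact lt_asymm this (hsx a ha)
        have hts : t ⊆ s.1 := (subset_insert_iff_of_notMem hxt).1 ht
        have : C' t = s.2 t := if_neg fun hn => hxt (mem_newTuples.1 hn).2.2
        refine Eq.trans ?_ this.symm
        rcases mem_insert.1 ha with rfl | ha
        · exact hpland t hts hcard
        · exact h3 t hts hcard a ha hlt
      · refine ⟨s, ?_, hland⟩
        rw [heq, Multiset.mem_add]
        exact Or.inl ((Multiset.mem_erase_of_ne hsp).2 hs)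
    · exact ⟨s, heq ▸ hs, hland⟩

/-- Each element adds only the children of one slot. The base `c + 1` is positive, so its powers are
monotone in the exponent even when `c = 0`. -/
theorem card_slots_le {D c n : ℕ} (hD : 0 < D) (C : TotalColouring) {l : List ℕ}
    (hl : l.Pairwise (· > ·)) (hn : ∀ a ∈ l, a < n) :
    Multiset.card (slots D c C l) ≤ 1 + l.length * (c + 1) ^ 2 ^ n := by
  induction l with
  | nil => simp [slots]
  | cons x l ih =>
    have hl' := List.pairwise_cons.1 hl
    have ih' := ih hl'.2 fun a ha => hn a (List.mem_cons_of_mem x ha)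
    rw [List.length_cons, add_mul, one_mul, ← add_assoc]
    rcases slots_cons_cases D c C x l with ⟨p, hp, -, heq⟩ | ⟨-, heq⟩
    · rw [heq, Multiset.card_add]
      refine add_le_add ((Multiset.card_le_card (Multiset.erase_le _ _)).trans ih') ?_
      refine (card_children_le D c p x).trans ?_
      refine (Nat.pow_le_pow_left (Nat.le_succ c) _).trans ?_
      refine Nat.pow_le_pow_right (Nat.succ_pos c) ((card_newTuples_le D p.1 x).trans ?_)
      refine Nat.pow_le_pow_right two_pos ?_
      rw [← card_range n]
      refine card_le_card fun a ha => mem_range.2 (hn a ?_)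
      have := insert_subset_insert x (slots_spec hD C hl'.2 hp).1 ha
      simpa using this
    · rw [heq]
      omega

/-! ### Rankings and the decreasing value of the tree -/

/-- The total value of a collection of slots. -/
noncomputable def weight (σ : Finset ℕ → TotalColouring → Form) (S : Multiset Slot) : Form :=
  (S.map fun s => σ s.1 s.2).sum

theorem coef_weight (σ : Finset ℕ → TotalColouring → Form) (S : Multiset Slot) (e : Ordinal) :
    (weight σ S).coef e = (S.map fun s => (σ s.1 s.2).coef e).sum := by
  induction S using Multiset.induction with
  | empty => simp [weight]
  | cons s S ih =>
    rw [weight, Multiset.map_cons, Multiset.sum_cons, coef_add, Multiset.map_cons,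
      Multiset.sum_cons, ← ih]
    rfl

theorem weight_add (σ : Finset ℕ → TotalColouring → Form) (S T : Multiset Slot) :
    weight σ (S + T) = weight σ S + weight σ T := by
  simp [weight]

/-- A value `σ A C` of the branch `A` with colouring `C` of its `D`-tuples that exceeds the sum
of the values of the children, with bounds on exponents and coefficients. -/
structure IsRanking (D c k : ℕ) (m b : ℕ → ℕ) (σ : Finset ℕ → TotalColouring → Form) : Prop where
  desc : ∀ A C x, Avoids D c C A → (∀ a ∈ A, a < x) →
    weight σ (children D c (A, C) x) < σ A C
  bound : ∀ A C n, Avoids D c C A → (∀ a ∈ A, a < n) → ∀ e, (σ A C).coef e ≠ 0 →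
    (σ A C).coef e ≤ m n ∧ 3 ≤ e ∧ Bounded k (b n) e

theorem IsRanking.weight_slots_cons_lt {D c k : ℕ} {m b : ℕ → ℕ}
    {σ : Finset ℕ → TotalColouring → Form} (hσ : IsRanking D c k m b σ) (hD : 0 < D)
    {C : TotalColouring} {l : List ℕ} {x : ℕ} (hl : (x :: l).Pairwise (· > ·))
    (h : Avoids (D + 1) c C (x :: l).toFinset) :
    weight σ (slots D c C (x :: l)) < weight σ (slots D c C l) := by
  have hl' := List.pairwise_cons.1 hl
  rw [List.toFinset_cons] at h
  rcases slots_cons_cases D c C x l with ⟨p, hp, -, heq⟩ | ⟨hno, -⟩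
  · obtain ⟨h1, h2, -⟩ := slots_spec hD C hl'.2 hp
    have hdesc := hσ.desc p.1 p.2 x h2 fun a ha => hl'.1 a (by simpa using h1 ha)
    have hS : weight σ (slots D c C l) = weight σ ((slots D c C l).erase p) + σ p.1 p.2 := by
      conv_lhs => rw [← Multiset.cons_erase hp]
      rw [weight, Multiset.map_cons, Multiset.sum_cons, add_comm]
      rfl
    rw [heq, weight_add, hS]
    exact add_lt_add_right hdesc _
  · exact absurd (exists_lands hD hl'.2 hl'.1 h) hno

theorem IsRanking.weight_slots_bound {D c k n : ℕ} {m b : ℕ → ℕ}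
    {σ : Finset ℕ → TotalColouring → Form} (hσ : IsRanking D c k m b σ) (hD : 0 < D)
    (C : TotalColouring) {l : List ℕ} (hl : l.Pairwise (· > ·)) (hn : ∀ a ∈ l, a < n)
    {e : Ordinal} (he : (weight σ (slots D c C l)).coef e ≠ 0) :
    (weight σ (slots D c C l)).coef e ≤ (1 + n * (c + 1) ^ 2 ^ n) * m n ∧ 3 ≤ e ∧
      Bounded k (b n) e := by
  have hspec : ∀ s ∈ slots D c C l, (σ s.1 s.2).coef e ≠ 0 →
      (σ s.1 s.2).coef e ≤ m n ∧ 3 ≤ e ∧ Bounded k (b n) e := by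
    intro s hs he
    obtain ⟨h1, h2, -⟩ := slots_spec hD C hl hs
    exact hσ.bound s.1 s.2 n h2 (fun a ha => hn a (by simpa using h1 ha)) e he
  rw [coef_weight] at he ⊢
  constructor
  · refine (Multiset.sum_le_card_nsmul _ (m n) ?_).trans ?_
    · intro y hy
      obtain ⟨s, hs, rfl⟩ := Multiset.mem_map.1 hy
      by_cases h0 : (σ s.1 s.2).coef e = 0
      · rw [h0]
        exact Nat.zero_le _
      · exact (hspec s hs h0).1
    · rw [Multiset.card_map, _root_.smul_eq_mul]
      refine Nat.mul_le_mul_right _ ((card_slots_le hD C hl hn).trans ?_)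
      refine add_le_add_right (Nat.mul_le_mul_right _ ?_) 1
      have hnd : l.Nodup := hl.imp fun h => ne_of_gt h
      rw [← List.toFinset_card_of_nodup hnd, ← card_range n]
      exact card_le_card fun a ha => mem_range.2 (hn a (by simpa using ha))
  · obtain ⟨s, hs, hne⟩ : ∃ s ∈ slots D c C l, (σ s.1 s.2).coef e ≠ 0 := by
      by_contra hno
      push Not at hno
      refine he (Multiset.sum_eq_zero fun y hy => ?_)
      obtain ⟨s, hs, rfl⟩ := Multiset.mem_map.1 hy
      exact hno s hs
    exact (hspec s hs hne).2

/-- The value of the Erdős–Rado tree of a colouring of the `(D + 1)`-tuples of `A`. -/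
noncomputable def treeForm (D c : ℕ) (σ : Finset ℕ → TotalColouring → Form) (A : Finset ℕ)
    (C : TotalColouring) : Form :=
  weight σ (slots D c C (A.sort (· ≥ ·)))

theorem pairwise_gt_sort (A : Finset ℕ) : (A.sort (· ≥ ·)).Pairwise (· > ·) := by
  have h1 := Finset.pairwise_sort A (· ≥ ·)
  have h2 := Finset.sort_nodup A (· ≥ ·)
  exact (h1.and h2).imp fun ⟨h, h'⟩ => lt_of_le_of_ne h (Ne.symm h')

theorem sort_insert_max {A : Finset ℕ} {x : ℕ} (hx : ∀ a ∈ A, a < x) :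
    (insert x A).sort (· ≥ ·) = x :: A.sort (· ≥ ·) :=
  Finset.sort_insert (r := (· ≥ ·)) (fun b hb => (hx b hb).le) fun h => lt_irrefl x (hx x h)

/-- The colouring may change on tuples containing `x`, because in `IsRanking.lift` the child carries
an extended colouring. -/
theorem IsRanking.treeForm_insert_lt {D c k : ℕ} {m b : ℕ → ℕ}
    {σ : Finset ℕ → TotalColouring → Form} (hσ : IsRanking D c k m b σ) (hD : 0 < D)
    {C C' : TotalColouring} {A : Finset ℕ} {x : ℕ} (hx : ∀ a ∈ A, a < x)
    (h : Avoids (D + 1) c C' (insert x A)) (hC : ∀ t ⊆ A, t.card = D + 1 → C' t = C t) :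
    treeForm D c σ (insert x A) C' < treeForm D c σ A C := by
  have hl := pairwise_gt_sort (insert x A)
  rw [treeForm, treeForm, ← slots_congr hD (pairwise_gt_sort A) (C := C')]
  · rw [sort_insert_max hx] at hl ⊢
    refine hσ.weight_slots_cons_lt hD hl ?_
    rw [List.toFinset_cons, sort_toFinset]
    exact h
  · rw [sort_toFinset]
    exact hC

theorem IsRanking.treeForm_bound {D c k n : ℕ} {m b : ℕ → ℕ}
    {σ : Finset ℕ → TotalColouring → Form} (hσ : IsRanking D c k m b σ) (hD : 0 < D)
    (C : TotalColouring) {A : Finset ℕ} (hn : ∀ a ∈ A, a < n)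
    {e : Ordinal} (he : (treeForm D c σ A C).coef e ≠ 0) :
    (treeForm D c σ A C).coef e ≤ (1 + n * (c + 1) ^ 2 ^ n) * m n ∧ 3 ≤ e ∧
      Bounded k (b n) e :=
  hσ.weight_slots_bound hD C (pairwise_gt_sort A) (fun a ha => hn a (by simpa using ha)) he

/-! ### Raising the dimension of a ranking -/

/-- The ranking of branches coloured on `(D + 1)`-tuples obtained from the tree values. -/
noncomputable def liftRanking (D c : ℕ) (σ : Finset ℕ → TotalColouring → Form) (A : Finset ℕ)
    (C : TotalColouring) : Form :=
  mono (treeForm D c σ A C + mono 0 3).val 1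

theorem weight_lt_mono {σ : Finset ℕ → TotalColouring → Form} {S : Multiset Slot} {e : Ordinal}
    {n : ℕ} (h : ∀ s ∈ S, ∀ e', e < e' → (σ s.1 s.2).coef e' = 0)
    (hn : (S.map fun s => (σ s.1 s.2).coef e).sum < n) : weight σ S < mono e n := by
  refine Form.lt_iff.2 ⟨e, fun e' he' => ?_, ?_⟩
  · rw [coef_mono_of_ne he'.ne', coef_weight]
    refine Multiset.sum_eq_zero fun y hy => ?_
    obtain ⟨s, hs, rfl⟩ := Multiset.mem_map.1 hy
    exact h s hs e' he'
  · rwa [coef_mono_same, coef_weight]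

/-- A drop of the tree value becomes a drop of the exponent, and `ω ^ e` exceeds every finite sum of
smaller powers, so the number of children is irrelevant. The new coefficient is 1 and the old ones
move into the exponent, so `m` and `b` are kept. In `hb`, the 4 is the added 3 plus one for
strictness. -/
theorem IsRanking.lift {D c k : ℕ} {m b : ℕ → ℕ}
    {σ : Finset ℕ → TotalColouring → Form} (hσ : IsRanking D c k m b σ) (hD : 0 < D)
    (hm : ∀ n, 1 ≤ m n) (hb : ∀ n, (1 + n * (c + 1) ^ 2 ^ n) * m n + 4 ≤ b n) :
    IsRanking (D + 1) c (k + 1) m b (liftRanking D c σ) where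
  desc A C x _ hx := by
    have hlt : ∀ s ∈ children (D + 1) c (A, C) x,
        (treeForm D c σ s.1 s.2 + KetonenSolovay.mono 0 3).val <
          (treeForm D c σ A C + KetonenSolovay.mono 0 3).val := by
      intro s hs
      obtain ⟨h1, h2, h3⟩ := mem_children.1 hs
      rw [h1] at h3 ⊢
      refine val_strictMono (add_lt_add_left (hσ.treeForm_insert_lt hD hx h3 ?_) _)
      intro t ht _
      exact (mem_extensions.1 h2).1 t fun hn =>
        lt_irrefl x (hx x (ht (mem_newTuples.1 hn).2.2))
    refine weight_lt_mono (fun s hs e' he' => ?_) ?_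
    · exact coef_mono_of_ne ((hlt s hs).trans he').ne' 1
    · refine lt_of_le_of_lt (le_of_eq (Multiset.sum_eq_zero fun y hy => ?_)) one_pos
      obtain ⟨s, hs, rfl⟩ := Multiset.mem_map.1 hy
      exact coef_mono_of_ne (hlt s hs).ne' 1
  bound A C n _ hn e he := by
    have he' := eq_of_coef_mono_ne_zero he
    subst he'
    refine ⟨by rw [liftRanking, coef_mono_same]; exact hm n, ?_, ?_⟩
    · have : (KetonenSolovay.mono 0 3).val = 3 := by simp
      rw [← this]
      refine val_strictMono.monotone ?_
      exact le_add_of_nonneg_left bot_le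
    · refine bounded_val.2 fun e he => ?_
      have hb' := hb n
      by_cases h0 : (treeForm D c σ A C).coef e = 0
      · rw [coef_add, h0, zero_add] at he ⊢
        rw [eq_of_coef_mono_ne_zero he, coef_mono_same]
        exact ⟨by omega, by simpa using bounded_natCast k (i := 0) (by omega)⟩
      · obtain ⟨h1, h2, h3⟩ := hσ.treeForm_bound hD C hn h0
        refine ⟨?_, h3⟩
        have : (KetonenSolovay.mono 0 3).coef e ≤ 3 := by
          rw [coef_mono]
          split_ifs <;> omega
        rw [coef_add]
        omega

/-! ### The ranking for colourings of singletons -/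

/-- The colours of the singletons of `A`. -/
def usedColours (C : TotalColouring) (A : Finset ℕ) : Finset ℕ := A.image fun a => C {a}

/-- The elements of `A` of colour `i`. -/
def colourClass (C : TotalColouring) (A : Finset ℕ) (i : ℕ) : Finset ℕ := A.filter fun a => C {a} = i

/-- The number of elements that can be added to the nonempty colour classes. -/
noncomputable def room (c : ℕ) (C : TotalColouring) (A : Finset ℕ) : ℕ :=
  ∑ i ∈ range c, (sInf (colourClass C A i : Set ℕ) - (colourClass C A i).card)

/-- The ranking of branches coloured on singletons. -/
noncomputable def baseRanking (c : ℕ) (A : Finset ℕ) (C : TotalColouring) : Form :=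
  mono ((3 + (c - (usedColours C A).card) : ℕ) : Ordinal) ((c + 1) ^ room c C A)

theorem mem_colourClass {C : TotalColouring} {A : Finset ℕ} {i a : ℕ} :
    a ∈ colourClass C A i ↔ a ∈ A ∧ C {a} = i := by
  simp [colourClass]

theorem usedColours_insert {C C' : TotalColouring} {A : Finset ℕ} {x : ℕ}
    (h : ∀ a ∈ A, C' {a} = C {a}) :
    usedColours C' (insert x A) = insert (C' {x}) (usedColours C A) := by
  rw [usedColours, image_insert, usedColours]
  congr 1
  exact image_congr fun a ha => h a ha

theorem colourClass_insert {C C' : TotalColouring} {A : Finset ℕ} {x : ℕ}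
    (h : ∀ a ∈ A, C' {a} = C {a}) (i : ℕ) :
    colourClass C' (insert x A) i =
      if C' {x} = i then insert x (colourClass C A i) else colourClass C A i := by
  have : colourClass C' A i = colourClass C A i :=
    filter_congr fun a ha => by rw [h a ha]
  rw [colourClass, filter_insert, ← this]
  rfl

theorem Avoids.card_colourClass_le {c i : ℕ} {C : TotalColouring} {A : Finset ℕ}
    (h : Avoids 1 c C A) (hne : (colourClass C A i).Nonempty) :
    (colourClass C A i).card ≤ sInf (colourClass C A i : Set ℕ) := by
  rw [hne.csInf_eq_min']
  refine h.card_le _ (filter_subset _ _) hne fun s t hs ht hs1 ht1 => ?_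
  obtain ⟨a, rfl⟩ := card_eq_one.1 hs1
  obtain ⟨b, rfl⟩ := card_eq_one.1 ht1
  rw [singleton_subset_iff] at hs ht
  rw [(mem_colourClass.1 hs).2, (mem_colourClass.1 ht).2]

theorem room_insert_lt {c : ℕ} {C C' : TotalColouring} {A : Finset ℕ} {x : ℕ}
    (h : ∀ a ∈ A, C' {a} = C {a}) (hx : ∀ a ∈ A, a < x) (hav : Avoids 1 c C' (insert x A))
    (hused : C' {x} ∈ usedColours C A) : room c C' (insert x A) < room c C A := by
  have hjc : C' {x} < c := hav.colour_lt _ (by simp) (card_singleton x)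
  refine Finset.sum_lt_sum (fun i _ => ?_) ⟨C' {x}, mem_range.2 hjc, ?_⟩
  · rw [colourClass_insert h]
    split_ifs with hi
    · subst hi
      obtain ⟨a, ha, hax⟩ := mem_image.1 hused
      have hne : (colourClass C A (C' {x})).Nonempty := ⟨a, mem_colourClass.2 ⟨ha, hax⟩⟩
      refine tsub_le_tsub ?_ ?_
      · exact csInf_le_csInf (OrderBot.bddBelow _) hne (by simp)
      · exact card_le_card (subset_insert _ _)
    · exact le_rfl
  · obtain ⟨a, ha, hax⟩ := mem_image.1 hused
    have hne : (colourClass C A (C' {x})).Nonempty := ⟨a, mem_colourClass.2 ⟨ha, hax⟩⟩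
    have hcl := colourClass_insert (x := x) h (C' {x})
    rw [if_pos rfl] at hcl
    -- The enlarged class still has size at most its minimum, so the truncated difference was
    -- positive and really drops.
    have hle := hav.card_colourClass_le (i := C' {x}) (by rw [hcl]; exact insert_nonempty _ _)
    have hxn : x ∉ colourClass C A (C' {x}) := fun hxm =>
      lt_irrefl x (hx x (mem_colourClass.1 hxm).1)
    rw [hcl] at hle ⊢
    rw [card_insert_of_notMem hxn] at hle ⊢
    have hinf : sInf ((insert x (colourClass C A (C' {x})) : Finset ℕ) : Set ℕ) ≤
        sInf (colourClass C A (C' {x}) : Set ℕ) :=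
      csInf_le_csInf (OrderBot.bddBelow _) hne (by simp)
    omega

theorem room_le {c n : ℕ} {C : TotalColouring} {A : Finset ℕ} (hn : ∀ a ∈ A, a < n) :
    room c C A ≤ c * n := by
  refine (Finset.sum_le_card_nsmul _ _ n fun i _ => ?_).trans (by simp)
  refine (Nat.sub_le _ _).trans ?_
  rcases (colourClass C A i).eq_empty_or_nonempty with h | h
  · simp [h]
  · rw [h.csInf_eq_min']
    exact (hn _ (mem_colourClass.1 (min'_mem _ h)).1).le

theorem usedColours_subset {c : ℕ} {C : TotalColouring} {A : Finset ℕ} (h : Avoids 1 c C A) :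
    usedColours C A ⊆ range c := by
  intro i hi
  obtain ⟨a, ha, rfl⟩ := mem_image.1 hi
  exact mem_range.2 (h.colour_lt _ (singleton_subset_iff.2 ha) (card_singleton a))

theorem newTuples_one (A : Finset ℕ) (x : ℕ) : (newTuples 1 A x).card ≤ 1 := by
  refine card_le_one.2 fun s hs t ht => ?_
  obtain ⟨-, hs1, hxs⟩ := mem_newTuples.1 hs
  obtain ⟨-, ht1, hxt⟩ := mem_newTuples.1 ht
  obtain ⟨a, rfl⟩ := card_eq_one.1 hs1
  obtain ⟨b, rfl⟩ := card_eq_one.1 ht1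
  rw [← mem_singleton.1 hxs, ← mem_singleton.1 hxt]

/-- A new colour lowers the exponent; an old one lowers the room `r`. Only `{x}` is recoloured, so
there are at most `c` children, and `c * (c + 1) ^ (r - 1) < (c + 1) ^ r`. The proof multiplies by
`c + 1` to avoid `r - 1`. -/
theorem isRanking_base (c : ℕ) {b : ℕ → ℕ} :
    IsRanking 1 c 0 (fun n => (c + 1) ^ (c * n)) b (baseRanking c) where
  desc A C x hA hx := by
    have hold : ∀ s ∈ children 1 c (A, C) x, ∀ a ∈ A, s.2 {a} = C {a} := by
      intro s hs a ha
      refine (mem_extensions.1 (mem_children.1 hs).2.1).1 _ fun hn => ?_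
      have := mem_singleton.1 (mem_newTuples.1 hn).2.2
      exact lt_irrefl x (hx x (this ▸ ha))
    have hcases : ∀ s ∈ children 1 c (A, C) x,
        usedColours s.2 s.1 = insert (s.2 {x}) (usedColours C A) ∧
        (s.2 {x} ∈ usedColours C A → room c s.2 s.1 < room c C A) ∧
        (s.2 {x} ∉ usedColours C A → (usedColours C A).card < c) := by
      intro s hs
      obtain ⟨h1, h2, h3⟩ := mem_children.1 hs
      have hu := usedColours_insert (x := x) (hold s hs)
      have hsub := usedColours_subset h3
      rw [h1] at h3 hsub ⊢
      refine ⟨hu, room_insert_lt (hold s hs) hx h3, fun hnew => ?_⟩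
      rw [hu] at hsub
      have := card_le_card hsub
      rw [card_insert_of_notMem hnew, card_range] at this
      omega
    refine weight_lt_mono (fun s hs e' he' => ?_) ?_
    · obtain ⟨hu, -, -⟩ := hcases s hs
      refine coef_mono_of_ne (ne_of_gt (lt_of_le_of_lt ?_ he')) _
      rw [hu]
      have := card_le_card (subset_insert (s.2 {x}) (usedColours C A))
      exact_mod_cast (by omega)
    · have hterm : ∀ s ∈ children 1 c (A, C) x,
          (c + 1) * (baseRanking c s.1 s.2).coef
            ((3 + (c - (usedColours C A).card) : ℕ) : Ordinal) ≤ (c + 1) ^ room c C A := by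
        intro s hs
        obtain ⟨hu, hold', hnew⟩ := hcases s hs
        by_cases hx' : s.2 {x} ∈ usedColours C A
        · rw [baseRanking, hu, insert_eq_of_mem hx', coef_mono_same, ← pow_succ']
          exact Nat.pow_le_pow_right (Nat.succ_pos c) (hold' hx')
        · have := hnew hx'
          rw [baseRanking, hu, card_insert_of_notMem hx', coef_mono_of_ne]
          · simp
          · exact_mod_cast (by omega)
      have hcard : Multiset.card (children 1 c (A, C) x) ≤ c := by
        refine (card_children_le 1 c (A, C) x).trans ?_
        rcases Nat.le_one_iff_eq_zero_or_eq_one.1 (newTuples_one A x) with h | h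
        · exfalso
          have : {x} ∈ newTuples 1 A x := mem_newTuples.2 ⟨by simp, by simp, by simp⟩
          rw [card_eq_zero.1 h] at this
          simp at this
        · simp [h]
      have hsum := Multiset.sum_le_card_nsmul ((children 1 c (A, C) x).map fun s =>
        (c + 1) * (baseRanking c s.1 s.2).coef
            ((3 + (c - (usedColours C A).card) : ℕ) : Ordinal)) ((c + 1) ^ room c C A) (by
          intro y hy
          obtain ⟨s, hs, rfl⟩ := Multiset.mem_map.1 hy
          exact hterm s hs)
      rw [Multiset.sum_map_mul_left, Multiset.card_map, _root_.smul_eq_mul] at hsum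
      have h1 : Multiset.card (children 1 c (A, C) x) * (c + 1) ^ room c C A <
          (c + 1) * (c + 1) ^ room c C A :=
        Nat.mul_lt_mul_of_pos_right (by omega) (by positivity)
      exact Nat.lt_of_mul_lt_mul_left (hsum.trans_lt h1)
  bound A C n _ hn e he := by
    have he' := eq_of_coef_mono_ne_zero he
    subst he'
    refine ⟨?_, ?_, natCast_lt_omega0 _⟩
    · rw [baseRanking, coef_mono_same]
      exact Nat.pow_le_pow_right (Nat.succ_pos c) (room_le hn)
    · exact_mod_cast Nat.le_add_right 3 _

/-! ### The iterated ranking and its initial value -/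

/-- The ranking of branches coloured on `(d + 1)`-tuples. -/
noncomputable def ranking (c : ℕ) : ℕ → Finset ℕ → TotalColouring → Form
  | 0 => baseRanking c
  | d + 1 => liftRanking (d + 1) c (ranking c d)

/-- A bound for the coefficients of tree values on sets of numbers below `n`. -/
def treeBound (c n : ℕ) : ℕ := (1 + n * (c + 1) ^ 2 ^ n) * (c + 1) ^ (c * n) + 4

theorem isRanking_ranking (c d : ℕ) :
    IsRanking (d + 1) c d (fun n => (c + 1) ^ (c * n)) (treeBound c) (ranking c d) := by
  induction d with
  | zero => exact isRanking_base c
  | succ d ih =>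
    exact ih.lift (Nat.succ_pos d) (fun n => Nat.one_le_pow _ _ (Nat.succ_pos c)) fun n => le_rfl

/-- The value of the empty tree. -/
theorem treeForm_empty (D c : ℕ) (σ : Finset ℕ → TotalColouring → Form) (C : TotalColouring) :
    treeForm D c σ ∅ C = σ ∅ fun _ => 0 := by
  simp [treeForm, slots, weight]

theorem opow_add_opow_le {a b e : Ordinal} (ha : a < e) (hb : b < e) : ω ^ a + ω ^ b ≤ ω ^ e := by
  have ha' : ω ^ a < ω ^ e := (opow_lt_opow_iff_right one_lt_omega0).2 ha
  have hb' : ω ^ b < ω ^ e := (opow_lt_opow_iff_right one_lt_omega0).2 hb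
  exact ((isPrincipal_add_omega0_opow e) ha' hb').le

/-- At the bottom the reserve `ω ^ 3` fits into the second copy of `ω ^ (c + 3)`. Higher up, the
reserve of the level below absorbs the 3 in the exponent, and powers of `ω` are additively
principal. -/
theorem treeForm_empty_le (c d : ℕ) (C : TotalColouring) :
    (treeForm (d + 1) c (ranking c d) ∅ C).val + ω ^ (3 : Ordinal) ≤
      tower d (ω ^ ((c + 3 : ℕ) : Ordinal) * 2 + 1) := by
  induction d generalizing C with
  | zero =>
    have h1 : (treeForm (0 + 1) c (ranking c 0) ∅ C).val = ω ^ ((c + 3 : ℕ) : Ordinal) := by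
      rw [treeForm_empty]
      -- All classes are empty and `sInf ∅ = 0`, so the room is 0 and the coefficient 1.
      simp [ranking, baseRanking, usedColours, room, colourClass, add_comm]
    have h2 (a : Ordinal) : a * 2 = a + a := by
      rw [show (2 : Ordinal) = 1 + 1 from one_add_one_eq_two.symm, mul_add, mul_one]
    rw [h1, tower, h2]
    refine le_trans ?_ (le_add_right le_rfl)
    refine add_le_add_right (opow_le_opow_right omega0_pos ?_) _
    exact_mod_cast Nat.le_add_left 3 c
  | succ d ih =>
    have h1 : (treeForm (d + 1 + 1) c (ranking c (d + 1)) ∅ C).val =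
        ω ^ ((treeForm (d + 1) c (ranking c d) ∅ fun _ => 0).val + 3) := by
      rw [treeForm_empty, ranking, liftRanking, val_mono, val_add, val_mono]
      · simp
      · intro e e' _ he'
        rw [eq_of_coef_mono_ne_zero he']
        exact zero_le
    rw [h1, tower]
    have h3 : (3 : Ordinal) < ω ^ (3 : Ordinal) := by
      refine lt_of_lt_of_le (natCast_lt_omega0 3) (left_le_opow _ (by norm_num))
    refine opow_add_opow_le (lt_of_lt_of_le ?_ (ih fun _ => 0)) (lt_of_lt_of_le ?_ (ih fun _ => 0))
    · exact (add_lt_add_iff_left _).2 h3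
    · exact h3.trans_le (le_add_left le_rfl)

/-! ### Growth estimates -/

theorem grow_one (n : ℕ) : grow 1 n = 2 * n := by
  have h : ∀ a m, (grow 0)^[a] m = m + a := by
    intro a
    induction a with
    | zero => intro m; rfl
    | succ a ih =>
      intro m
      rw [Function.iterate_succ_apply, ih, grow]
      omega
  rw [grow, h]
  omega

theorem grow_two (n : ℕ) : grow 2 n = 2 ^ n * n := by
  have h : ∀ a m, (grow 1)^[a] m = 2 ^ a * m := by
    intro a
    induction a with
    | zero => intro m; simp
    | succ a ih =>
      intro m
      rw [Function.iterate_succ_apply, ih, grow_one, pow_succ]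
      ring
  rw [grow, h]

theorem two_pow_le_grow_three {n : ℕ} (hn : 4 ≤ n) : 2 ^ 2 ^ 2 ^ 2 ^ n ≤ grow 3 n := by
  have h2 : ∀ a b, 0 < b → a ≤ b → 2 ^ a ≤ grow 2 b := fun a b hb hab => by
    rw [grow_two]
    exact (Nat.pow_le_pow_right two_pos hab).trans (Nat.le_mul_of_pos_right _ hb)
  have hpos : ∀ b, 0 < b → 0 < grow 2 b := fun b hb => hb.trans_le (le_grow 2 b)
  obtain ⟨m, rfl⟩ := Nat.exists_eq_add_of_le hn
  have hstep : (grow 2)^[4 + m] (4 + m) = (grow 2)^[m] ((grow 2)^[4] (4 + m)) := by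
    rw [← Function.iterate_add_apply, add_comm]
  rw [grow, hstep]
  refine le_trans ?_ (Function.id_le_iterate_of_id_le (le_grow 2) m _)
  have p0 : 0 < 4 + m := by omega
  exact h2 _ _ (hpos _ (hpos _ (hpos _ p0))) (h2 _ _ (hpos _ (hpos _ p0))
    (h2 _ _ (hpos _ p0) (h2 _ _ p0 le_rfl)))

theorem treeBound_le {c n : ℕ} (hc : c < n) (hn : 4 ≤ n) : treeBound c n ≤ 2 ^ 2 ^ 2 ^ n := by
  have hcn : c + 1 ≤ 2 ^ n := (Nat.succ_le_of_lt hc).trans Nat.lt_two_pow_self.le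
  have h1 : (c + 1) ^ 2 ^ n ≤ 2 ^ (n * 2 ^ n) := by
    rw [pow_mul]
    exact Nat.pow_le_pow_left hcn _
  have h2 : (c + 1) ^ (c * n) ≤ 2 ^ (n * (n * n)) := by
    rw [pow_mul 2]
    exact (Nat.pow_le_pow_left hcn _).trans
      (Nat.pow_le_pow_right (by positivity) (Nat.mul_le_mul_right n hc.le))
  have h3 : 1 + n * (c + 1) ^ 2 ^ n ≤ 2 ^ (n + n * 2 ^ n) := by
    rw [pow_add]
    have h4 : n + 1 ≤ 2 ^ n := Nat.lt_two_pow_self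
    have h5 : 1 ≤ 2 ^ (n * 2 ^ n) := Nat.one_le_two_pow
    calc 1 + n * (c + 1) ^ 2 ^ n ≤ (n + 1) * 2 ^ (n * 2 ^ n) := by nlinarith
      _ ≤ _ := Nat.mul_le_mul_right _ h4
  have h6 : treeBound c n ≤ 2 ^ (n + n * 2 ^ n + n * (n * n) + 3) := by
    have h7 := Nat.mul_le_mul h3 h2
    rw [← pow_add] at h7
    have h8 : 1 ≤ 2 ^ (n + n * 2 ^ n + n * (n * n)) := Nat.one_le_two_pow
    rw [pow_add _ _ 3, treeBound]
    omega
  refine h6.trans (Nat.pow_le_pow_right two_pos ?_)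
  have hsq : n * n ≤ 2 ^ n := by
    clear * - hn
    induction n, hn using Nat.le_induction with
    | base => norm_num
    | succ n hn ih => rw [pow_succ]; nlinarith
  have hlt : n < 2 ^ n := Nat.lt_two_pow_self
  have hy : 16 ≤ 2 ^ n := (Nat.pow_le_pow_right two_pos hn : 2 ^ 4 ≤ 2 ^ n)
  have hlin : 2 * n + 2 ≤ 2 ^ n := by nlinarith
  calc n + n * 2 ^ n + n * (n * n) + 3 ≤ 2 ^ n * 2 ^ n * 4 := by nlinarith
    _ = 2 ^ (2 * n + 2) := by rw [pow_add, two_mul, pow_add]; norm_num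
    _ ≤ 2 ^ 2 ^ n := Nat.pow_le_pow_right two_pos hlin

theorem treeBound_succ_le_grow {c x : ℕ} (hx : c + 6 ≤ x) :
    treeBound c (x + 1) ≤ grow 3 x := by
  refine (treeBound_le (by omega) (by omega)).trans
    (le_trans ?_ (two_pow_le_grow_three (by omega)))
  have h : x + 1 ≤ 2 ^ x := Nat.lt_two_pow_self
  exact Nat.pow_le_pow_right two_pos (Nat.pow_le_pow_right two_pos
    (Nat.pow_le_pow_right two_pos h))

/-! ### Reaching the initial value, and the contradiction -/

theorem descent_three {α : NONote} {X : Finset ℕ} (hX : ∀ x ∈ X, 3 ≤ x) :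
    descent α X 3 = α := by
  have h : ∀ n < 3, n ∉ X := fun n hn hnX => absurd (hX n hnX) (by omega)
  simp only [descent, if_neg (h 0 (by norm_num)), if_neg (h 1 (by norm_num)),
    if_neg (h 2 (by norm_num))]

/-- From time 3 on, the descent is compared with towers over `ω ^ (c + 3) * 2 + ω ^ i`, where `i`
runs from `c + 2` down to 0. These `c + 3` steps end at time `c + 6`. The coefficient 2 is
admissible because no step happens before time 3. -/
theorem tower_le_descent {c d : ℕ} {α : NONote} {X : Finset ℕ} (hX : ∀ x ∈ X, 3 ≤ x)
    (hle : tower d (ω ^ ((c + 4 : ℕ) : Ordinal)) ≤ α.repr) (hlt : α.repr < tower (d + 1) ω) :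
    tower d (ω ^ ((c + 3 : ℕ) : Ordinal) * 2 + 1) ≤ (descent α X (c + 6)).repr := by
  have hval : ∀ i < c + 3, (mono ((c + 3 : ℕ) : Ordinal) 2 + mono (i : Ordinal) 1).val =
      ω ^ ((c + 3 : ℕ) : Ordinal) * 2 + ω ^ (i : Ordinal) := by
    intro i hi
    rw [val_add, val_mono, val_mono]
    · simp
    · intro e e' he he'
      rw [eq_of_coef_mono_ne_zero he, eq_of_coef_mono_ne_zero he']
      exact_mod_cast hi.le
  have hB : ∀ i < c + 3, ∀ x, 3 ≤ x →
      Bounded (d + 1) x (tower d (ω ^ ((c + 3 : ℕ) : Ordinal) * 2 + ω ^ (i : Ordinal))) := by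
    intro i hi x hx
    rw [add_comm d 1]
    refine bounded_tower (by omega) ?_ d
    rw [← hval i hi]
    refine bounded_val.2 fun e he => ?_
    rw [coef_add, coef_mono, coef_mono] at he ⊢
    split_ifs at he ⊢ with h1 h2 h2
    · exact absurd (h1.symm.trans h2) (by exact_mod_cast hi.ne')
    · exact ⟨by omega, h1 ▸ natCast_lt_omega0 _⟩
    · exact ⟨by omega, h2 ▸ natCast_lt_omega0 _⟩
    · exact absurd rfl he
  have key : ∀ j i, i + j = c + 2 →
      tower d (ω ^ ((c + 3 : ℕ) : Ordinal) * 2 + ω ^ (i : Ordinal)) ≤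
        (descent α X (j + 4)).repr := by
    intro j
    induction j with
    | zero =>
      intro i hi
      refine le_descent_succ hlt (by omega) (hB i (by omega) 3 le_rfl) ?_
      rw [descent_three hX]
      refine lt_of_lt_of_le (tower_strictMono d ?_) hle
      refine opow_mul_add_lt_opow (natCast_lt_omega0 2) ?_ ?_
      · exact (opow_lt_opow_iff_right one_lt_omega0).2 (by exact_mod_cast (by omega))
      · exact_mod_cast Nat.lt_succ_self _
    | succ j ih =>
      intro i hi
      refine le_descent_succ hlt (by omega) (hB i (by omega) _ (by omega)) ?_
      refine lt_of_lt_of_le (tower_strictMono d ?_) (ih (i + 1) (by omega))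
      refine (add_lt_add_iff_left _).2 ((opow_lt_opow_iff_right one_lt_omega0).2 ?_)
      exact_mod_cast Nat.lt_succ_self i
  simpa using key (c + 2) 0 (by omega)

theorem filter_lt_succ_of_mem {X : Finset ℕ} {x : ℕ} (hx : x ∈ X) :
    X.filter (· < x + 1) = insert x (X.filter (· < x)) := by
  ext a
  simp only [mem_filter, mem_insert]
  constructor
  · rintro ⟨h1, h2⟩
    rcases Nat.lt_succ_iff_lt_or_eq.1 h2 with h | h
    · exact Or.inr ⟨h1, h⟩
    · exact Or.inl h
  · rintro (rfl | ⟨h1, h2⟩)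
    · exact ⟨hx, by omega⟩
    · exact ⟨h1, by omega⟩

theorem filter_lt_succ_of_notMem {X : Finset ℕ} {x : ℕ} (hx : x ∉ X) :
    X.filter (· < x + 1) = X.filter (· < x) := by
  refine filter_congr fun a ha => ?_
  have : a ≠ x := fun h => hx (h ▸ ha)
  omega

theorem not_avoids_of_isLarge {c d : ℕ} {α : NONote} {X : Finset ℕ} (hX : ∀ x ∈ X, 3 ≤ x)
    (hle : tower d (ω ^ ((c + 4 : ℕ) : Ordinal)) ≤ α.repr) (hlt : α.repr < tower (d + 1) ω)
    (hlarge : IsLarge α X) (C : TotalColouring) : ¬ Avoids (d + 2) c C X := by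
  intro hC
  have hr := isRanking_ranking c d
  have hD : 0 < d + 1 := Nat.succ_pos d
  set v : ℕ → Form := fun n => treeForm (d + 1) c (ranking c d) (X.filter (· < n)) C with hv
  have hstep : ∀ x ∈ X, v (x + 1) < v x := by
    intro x hx
    simp only [hv]
    rw [filter_lt_succ_of_mem hx]
    refine hr.treeForm_insert_lt hD (fun a ha => (mem_filter.1 ha).2) ?_ fun _ _ _ => rfl
    exact hC.subset (insert_subset hx (filter_subset _ _))
  have hanti : Antitone v := by
    refine antitone_nat_of_succ_le fun n => ?_
    by_cases hn : n ∈ X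
    · exact (hstep n hn).le
    · simp only [hv]
      rw [filter_lt_succ_of_notMem hn]
  have hbound : ∀ n e, (v n).coef e ≠ 0 →
      (v n).coef e < treeBound c n ∧ 3 ≤ e ∧ Bounded d (treeBound c n) e := by
    intro n e he
    obtain ⟨h1, h2, h3⟩ := hr.treeForm_bound hD C (fun a ha => (mem_filter.1 ha).2) he
    exact ⟨lt_of_le_of_lt h1 (Nat.lt_add_of_pos_right (by norm_num)), h2, h3⟩
  have hstart : (v 0 + mono 3 1).val ≤ (descent α X (c + 6)).repr := by
    refine le_trans ?_ (tower_le_descent hX hle hlt)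
    rw [val_add, val_mono, Nat.cast_one, mul_one]
    · have : X.filter (· < 0) = ∅ := by simp
      simp only [hv, this]
      exact treeForm_empty_le c d C
    · intro e e' he he'
      rw [eq_of_coef_mono_ne_zero he']
      exact (hbound 0 e he).2.1
  obtain ⟨N, hN⟩ := hlarge.exists_descent_eq_zero
  have hpos := descent_pos hlt (v := v) (b := treeBound c) (T := c + 6) (by omega)
    (fun x hx w hw => (hstep x hx).trans_le (hanti hw))
    (fun n e he => (hbound n e he).2.1)
    (fun n e he => ⟨(hbound n e he).1, (hbound n e he).2.2⟩)
    (fun x hx => treeBound_succ_le_grow hx) (by simp [treeBound]) hstart N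
  rw [hN] at hpos
  exact lt_irrefl _ hpos

theorem hasLargeHomogeneous_of_isLarge {c d : ℕ} {α : NONote} {X : Finset ℕ}
    (hX : ∀ x ∈ X, 3 ≤ x) (hle : tower d (ω ^ ((c + 4 : ℕ) : Ordinal)) ≤ α.repr)
    (hlt : α.repr < tower (d + 1) ω) (hlarge : IsLarge α X) :
    HasLargeHomogeneous X (d + 2) c := by
  intro C
  by_contra hno
  set C' : TotalColouring := fun t =>
    if h : t ⊆ X ∧ t.card = d + 2 then (C ⟨t, h⟩ : ℕ) else 0 with hC'
  have hval : ∀ t (h : t ⊆ X ∧ t.card = d + 2), C' t = (C ⟨t, h⟩ : ℕ) := fun t h => dif_pos h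
  refine not_avoids_of_isLarge hX hle hlt hlarge C' ⟨fun t ht hcard => ?_, fun H hH hne hom => ?_⟩
  · rw [hval t ⟨ht, hcard⟩]
    exact (C ⟨t, ht, hcard⟩).2
  · by_contra hlt'
    refine hno ⟨H, hH, fun s t hs ht => Fin.ext ?_, hne, not_le.1 hlt'⟩
    have := hom s.1 t.1 hs ht s.2.2 t.2.2
    rwa [hval s.1 s.2, hval t.1 t.2] at this

/-! ### Values of the notations in the theorem -/

theorem repr_omegaPow (α : NONote) : (omegaPow α).repr = ω ^ α.repr := by
  change (ONote.oadd α.1 1 0).repr = ω ^ α.1.repr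
  simp [ONote.repr]

theorem repr_omegaTower (d : ℕ) (α : NONote) : (omegaTower d α).repr = tower d α.repr := by
  induction d with
  | zero => rfl
  | succ d ih => rw [omegaTower, repr_omegaPow, ih, tower]

theorem repr_ofNat (n : ℕ) : (NONote.ofNat n).repr = n := ONote.repr_ofNat n

theorem tower_opow (d : ℕ) (α : Ordinal) : tower d (ω ^ α) = tower (d + 1) α := by
  induction d with
  | zero => rfl
  | succ d ih =>
    rw [tower, ih]
    rfl

end KetonenSolovay

theorem mainTheorem3 :
    (∀ (d c : ℕ) (X : Finset ℕ), (∀ x ∈ X, 3 ≤ x) →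
      KetonenSolovay.IsLarge
        (KetonenSolovay.omegaTower d
          (KetonenSolovay.omegaPow (NONote.ofNat (c + 4)) + NONote.ofNat d)) X →
      KetonenSolovay.HasLargeHomogeneous X (d + 2) c) ∧
    (∀ (d c : ℕ) (X : Finset ℕ), (∀ x ∈ X, 3 ≤ x) →
      KetonenSolovay.IsLarge
        (KetonenSolovay.omegaTower (d + 1) (NONote.ofNat (c + 5))) X →
      KetonenSolovay.HasLargeHomogeneous X (d + 2) c) := by
  constructor
  · intro d c X hX hlarge
    refine KetonenSolovay.hasLargeHomogeneous_of_isLarge hX ?_ ?_ hlarge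
    · rw [KetonenSolovay.repr_omegaTower, NONote.repr_add, KetonenSolovay.repr_omegaPow,
        KetonenSolovay.repr_ofNat]
      exact (KetonenSolovay.tower_strictMono d).monotone (le_add_right le_rfl)
    · rw [KetonenSolovay.repr_omegaTower, NONote.repr_add, KetonenSolovay.repr_omegaPow,
        KetonenSolovay.repr_ofNat, KetonenSolovay.repr_ofNat, ← KetonenSolovay.tower_opow]
      refine KetonenSolovay.tower_strictMono d ?_
      refine Ordinal.isPrincipal_add_omega0_opow _ ?_ ?_
      · exact (Ordinal.opow_lt_opow_iff_right Ordinal.one_lt_omega0).2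
          (Ordinal.natCast_lt_omega0 _)
      · exact (Ordinal.natCast_lt_omega0 d).trans_le
          (Ordinal.left_le_opow _ Ordinal.omega0_pos)
  · intro d c X hX hlarge
    refine KetonenSolovay.hasLargeHomogeneous_of_isLarge hX ?_ ?_ hlarge
    · rw [KetonenSolovay.repr_omegaTower, KetonenSolovay.repr_ofNat,
        KetonenSolovay.tower_opow]
      refine (KetonenSolovay.tower_strictMono (d + 1)).monotone ?_
      exact_mod_cast Nat.le_succ (c + 4)
    · rw [KetonenSolovay.repr_omegaTower, KetonenSolovay.repr_ofNat]
      exact KetonenSolovay.tower_strictMono (d + 1) (Ordinal.natCast_lt_omega0 _)
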